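/- Let $k=\mathbf{F}_q$ be a finite field of characteristic $>2$, $F=k(\!(\epsilon)\!)$, $\mathcal{O}=k[\![\epsilon]\!]$, $G=\mathrm{GL}_2$, $K=G[\![\epsilon]\!]$, and let $\mathscr{X}=G(\!(\epsilon)\!)/K$ be the affine grassmannian, so that $\mathscr X(k)=\mathrm{GL}_2(F)/\mathrm{GL}_2(\mathcal O)$. Let $I\subset K$ be the standard Iwahori subgroup, the preimage of the upper triangular matrices under reduction modulo $\epsilon$. Let $n\ge 0$ be an integer, $b_0\in\mathcal{O}^{\times}$, and $$\gamma=\begin{bmatrix}0&b_0\epsilon^{n}\\ b_0\epsilon^{n+1}&0\end{bmatrix},\qquad \mathscr{X}_\gamma=\{[g]\in\mathscr{X}\mid \mathrm{Ad}(g)^{-1}\gamma\in\mathfrak{g}[\![\epsilon]\!]\}.$$ (1) For all $(a_1,a_2)\in\mathbf{Z}^2$, $$\mathscr{X}_\gamma\cap I\begin{pmatrix}\epsilon^{a_1}&\\&\epsilon^{a_2}\end{pmatrix}K/K=\begin{cases}I\begin{pmatrix}\epsilon^{a_1}&\\&\epsilon^{a_2}\end{pmatrix}K/K,&\text{if }-(n+1)\le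 a_1-a_2\le n;\\ \emptyset,&\text{otherwise,}\end{cases}$$ and this holds on points in every nonzero commutative $k$-algebra $R$, that is, in $\mathrm{GL}_2(R(\!(\epsilon)\!))/\mathrm{GL}_2(R[\![\epsilon]\!])$. (2) Let $T(F)$ be the centralizer of $\gamma$ in $\mathrm{GL}_2(F)$ and $T(\mathcal{O})=T(F)\cap\mathrm{GL}_2(\mathcal{O})$. There are Haar measures $dg$ on $\mathrm{GL}_2(F)$ and $dt$ on $T(F)$ giving volume $1$ to $\mathrm{GL}_2(\mathcal{O})$ and $T(\mathcal{O})$, and a quotient measure $\frac{dg}{dt}$ on $T(F)\backslash\mathrm{GL}_2(F)$, i.e. a measure with $\int_{\mathrm{GL}_2(F)} f(g)\,dg=\int_{T(F)\backslash \mathrm{GL}_2(F)}\int_{T(F)}f(tg)\,dt\,\frac{dg}{dt}$ for all measurable $f\ge0$. For such measures put $$I_\gamma^G=\int_{T(F)\backslash\mathrm{GL}_2(F)}\mathbb{1}_{\mathfrak{g}(\mathcal{O})}(\mathrm{Ad}(g)^{-1}\gamma)\frac{dg}{dt},\qquad J_G^\xi(\gamma)=\int_{T(F)\backslash\mathrm{GL}_2(F)}\mathbb{1}_{\mathfrak{g}(\mathcal{O})}(\mathrm{Ad}(g)^{-1}\gamma)\,\mathrm{w}_G^\xi(g)\frac{dg}{dt},$$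 where $\xi\in\mathfrak{a}_G^G$ and $\mathrm{w}_G^\xi(g)$ is the number of integral points (points of the image of $\Lambda_G\cong\mathbf{Z}$ in $\mathfrak{a}_G^G$) of the polytope $\mathrm{Ec}_G([g])-\xi$; here $\mathfrak a_G^G=\mathfrak a_G\cap\mathfrak a_A^G$, with $A$ the diagonal torus, $\mathfrak a_A=\mathbf R^2$, $\mathfrak a_G=\{x_1=x_2\}$ and $\mathfrak a_A^G=\{x_1+x_2=0\}$, and $\mathrm{Ec}_G([g])\subset\mathfrak{a}_G^G$ is the convex hull of the image $H_G([g])$ of $\nu_G([g])=\mathrm{val}(\det g)\in\Lambda_G$. (As $\gamma$ is anisotropic modulo the centre, the Levi subgroup $M_0$ attached to it is $G$ itself.) A point $[g]\in\mathscr{X}_\gamma(k)$ is regular if the reduction of $\mathrm{Ad}(g)^{-1}\gamma$ modulo $\epsilon$ is regular, i.e. has a $2$-dimensional centralizer in $\mathfrak{gl}_2(k)$. Then there is a regular point $x_0\in\mathscr{X}_\gamma(k)$ with $\nu_G(x_0)=0$; and for every regular point $x_0\in\mathscr{X}_\gamma(k)$, with the fundamental domain $$F_\gamma(\mathbf{F}_q)=\{x\in\mathscr{X}_\gamma(k)\mid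 \mathrm{Ec}_G(x)\subset\mathrm{Ec}_G(x_0),\ \nu_G(x)=\nu_G(x_0)\},$$ the set $F_\gamma(\mathbf F_q)$ is finite and, for every $\xi\in\mathfrak a_G^G$, one has $$J_G^\xi(\gamma)=I_\gamma^G=|F_\gamma(\mathbf{F}_q)|=\sum_{i=0}^{n}q^{i}.$$ -/

import Mathlib

open Matrix MeasureTheory
open scoped LaurentSeries PowerSeries ENNReal

noncomputable section

namespace GL2Springer

/-! ### The loop group of `GL₂`, its arc group, the Iwahori subgroup, the affine Grassmannian -/

section Loop

variable (R : Type*) [CommRing R]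

/-- The inclusion `R⟦ε⟧ → R((ε))`. -/
abbrev incl : R⟦X⟧ →+* R⸨X⸩ := HahnSeries.ofPowerSeries ℤ R

/-- `K = GL₂(R⟦ε⟧)`, as a subgroup of `GL₂(R((ε)))`. -/
def arcGroup : Subgroup (GL (Fin 2) R⸨X⸩) :=
  (GeneralLinearGroup.map (n := Fin 2) (incl R)).range

/-- The Borel subgroup `B₀` of upper triangular matrices in `GL₂(R)`. -/
def borelSubgroup : Subgroup (GL (Fin 2) R) where
  carrier := {g | g 1 0 = 0}
  one_mem' := by simp
  mul_mem' := by
    intro a b ha hb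
    simp only [Set.mem_ofPred_eq] at ha hb ⊢
    simp [Matrix.mul_apply, Fin.sum_univ_two, ha, hb]
  inv_mem' := by
    intro a ha
    simp only [Set.mem_ofPred_eq] at ha ⊢
    rw [Matrix.coe_units_inv, Matrix.inv_def, Matrix.adjugate_fin_two]
    simp [ha]

/-- The standard Iwahori subgroup `I ⊆ K`: the preimage of `B₀` under the reduction
`GL₂(R⟦ε⟧) → GL₂(R)` modulo `ε`, seen inside `GL₂(R((ε)))`. -/
def iwahori : Subgroup (GL (Fin 2) R⸨X⸩) :=
  ((borelSubgroup R).comap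
    (GeneralLinearGroup.map (n := Fin 2) (PowerSeries.constantCoeff (R := R)))).map
      (GeneralLinearGroup.map (n := Fin 2) (incl R))

/-- The diagonal matrix `diag(ε^a₁, ε^a₂)` in `GL₂(R((ε)))`. -/
def epsDiag (a₁ a₂ : ℤ) : GL (Fin 2) R⸨X⸩ where
  val := !![HahnSeries.single a₁ 1, 0; 0, HahnSeries.single a₂ 1]
  inv := !![HahnSeries.single (-a₁) 1, 0; 0, HahnSeries.single (-a₂) 1]
  val_inv := by
    ext i j : 2
    fin_cases i <;> fin_cases j <;>
      simp [Matrix.mul_apply, Fin.sum_univ_two, HahnSeries.single_mul_single]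
  inv_val := by
    ext i j : 2
    fin_cases i <;> fin_cases j <;>
      simp [Matrix.mul_apply, Fin.sum_univ_two, HahnSeries.single_mul_single]

/-- `𝒳(R) = GL₂(R((ε))) / GL₂(R⟦ε⟧)`. For a field (or a local ring) `R` these are the `R`-points
of the affine Grassmannian `𝒳`; in general `𝒳` is the sheaf attached to this presheaf. -/
abbrev AffGr : Type _ := GL (Fin 2) R⸨X⸩ ⧸ arcGroup R

/-- The class `[g] = gK`. -/
abbrev cls (g : GL (Fin 2) R⸨X⸩) : AffGr R := QuotientGroup.mk g

/-- The orbit `I · diag(ε^a₁, ε^a₂) K / K` in `𝒳(R)`. -/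
def iwahoriOrbit (a₁ a₂ : ℤ) : Set (AffGr R) :=
  {x | ∃ i ∈ iwahori R, x = cls R (i * epsDiag R a₁ a₂)}

variable {R}

/-- `Ad(g)⁻¹ A = g⁻¹ A g`. -/
def adInv (g : GL (Fin 2) R⸨X⸩) (A : Matrix (Fin 2) (Fin 2) R⸨X⸩) :
    Matrix (Fin 2) (Fin 2) R⸨X⸩ :=
  (↑(g⁻¹) : Matrix (Fin 2) (Fin 2) R⸨X⸩) * A * (↑g : Matrix (Fin 2) (Fin 2) R⸨X⸩)

variable (R) in
/-- The lattice `𝔤(𝒪) = 𝔤𝔩₂(R⟦ε⟧)` in `𝔤𝔩₂(R((ε)))`. -/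
def latticeGO : Set (Matrix (Fin 2) (Fin 2) R⸨X⸩) :=
  Set.range fun B : Matrix (Fin 2) (Fin 2) R⟦X⟧ => B.map (incl R)

/-- The affine Springer fiber `𝒳_γ = {[g] ∈ 𝒳 | Ad(g)⁻¹ γ ∈ 𝔤(𝒪)}`. -/
def springerFiber (γ : Matrix (Fin 2) (Fin 2) R⸨X⸩) : Set (AffGr R) :=
  {x | ∃ g, x = cls R g ∧ adInv g γ ∈ latticeGO R}

/-- The matrix `γ = [[0, b₀ εⁿ], [b₀ εⁿ⁺¹, 0]]`. -/
def ramifiedGamma (b₀ : R⟦X⟧) (n : ℕ) : Matrix (Fin 2) (Fin 2) R⸨X⸩ :=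
  (!![0, b₀ * PowerSeries.X ^ n; b₀ * PowerSeries.X ^ (n + 1), 0] :
    Matrix (Fin 2) (Fin 2) R⟦X⟧).map (incl R)

end Loop

/-! ### The map `H_G`, the polytope `Ec_G` and the weight factor (the case `M₀ = G`) -/

/-- The projection of `𝔞_A = ℝ²` onto `𝔞_G = {x | x 0 = x 1}` along
`𝔞_A^G = {x | x 0 + x 1 = 0}`. -/
def projG (x : Fin 2 → ℝ) : Fin 2 → ℝ := fun _ => (x 0 + x 1) / 2

/-- The complementary projection of `𝔞_A = ℝ²` onto `𝔞_A^G = {x | x 0 + x 1 = 0}`. -/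
def projAG (x : Fin 2 → ℝ) : Fin 2 → ℝ := x - projG x

/-- The space `𝔞_G^G = 𝔞_G ∩ 𝔞_A^G`. -/
def aGG : Submodule ℝ (Fin 2 → ℝ) where
  carrier := {x | x 0 = x 1 ∧ x 0 + x 1 = 0}
  add_mem' := by
    rintro x y ⟨hx, hx'⟩ ⟨hy, hy'⟩
    exact ⟨by simp [hx, hy], by simp only [Pi.add_apply]; linarith⟩
  zero_mem' := by simp
  smul_mem' := by
    rintro c x ⟨hx, hx'⟩
    exact ⟨by simp [hx], by simp only [Pi.smul_apply, smul_eq_mul]; rw [← mul_add, hx', mul_zero]⟩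

/-- The map `Λ_G → 𝔞_G^G`. Here `Λ_G = X_*(A)/ℤα^∨` is identified with `ℤ` by the sum of the two
coordinates on `X_*(A) = ℤ²`; the class `l` is sent to the image of `(l, 0)` in `𝔞_G` and then
to `𝔞_G^G`. -/
def latticeToAGG (l : ℤ) : Fin 2 → ℝ := projAG (projG ![(l : ℝ), 0])

section Weight

variable {k : Type*} [Field k]

lemma det_ne_zero_GL (g : GL (Fin 2) k⸨X⸩) : (g : Matrix (Fin 2) (Fin 2) k⸨X⸩).det ≠ 0 :=
  ((Matrix.isUnit_iff_isUnit_det _).mp g.isUnit).ne_zero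

lemma order_det_of_mem_arcGroup {h : GL (Fin 2) k⸨X⸩} (hh : h ∈ arcGroup k) :
    (h : Matrix (Fin 2) (Fin 2) k⸨X⸩).det.order = 0 := by
  have key : ∀ h : GL (Fin 2) k⸨X⸩, h ∈ arcGroup k →
      0 ≤ (h : Matrix (Fin 2) (Fin 2) k⸨X⸩).det.order := by
    rintro _ ⟨κ, rfl⟩
    have hdet : ((GeneralLinearGroup.map (n := Fin 2) (incl k) κ : GL (Fin 2) k⸨X⸩) :
        Matrix (Fin 2) (Fin 2) k⸨X⸩).det
          = incl k (κ : Matrix (Fin 2) (Fin 2) k⟦X⟧).det := by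
      rw [RingHom.map_det]; rfl
    have hne : incl k (κ : Matrix (Fin 2) (Fin 2) k⟦X⟧).det ≠ 0 := by
      rw [← hdet]; exact det_ne_zero_GL _
    rw [hdet]
    by_contra! hlt
    apply hne
    rw [← HahnSeries.coeff_order_eq_zero]
    exact (PowerSeries.coeff_coe _ _).trans (if_pos hlt)
  have h1 := key h hh
  have h2 := key h⁻¹ (inv_mem hh)
  have h3 : (h : Matrix (Fin 2) (Fin 2) k⸨X⸩).det.order +
      ((h⁻¹ : GL (Fin 2) k⸨X⸩) : Matrix (Fin 2) (Fin 2) k⸨X⸩).det.order = 0 := by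
    rw [← HahnSeries.order_mul (det_ne_zero_GL h) (det_ne_zero_GL h⁻¹), ← Matrix.det_mul, ← Units.val_mul]
    simp
  omega

/-- The map `ν_G : 𝒳(k) → Λ_G = ℤ`, `[g] ↦ val(det g)`. -/
def nuG : AffGr k → ℤ :=
  Quotient.lift (fun g : GL (Fin 2) k⸨X⸩ => (g : Matrix (Fin 2) (Fin 2) k⸨X⸩).det.order) (by
    intro g g' h
    have h' : g⁻¹ * g' ∈ arcGroup k := QuotientGroup.leftRel_apply.mp h
    have h0 := order_det_of_mem_arcGroup h'
    have hg : g' = g * (g⁻¹ * g') := by group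
    have : (g' : Matrix (Fin 2) (Fin 2) k⸨X⸩).det
        = (g : Matrix (Fin 2) (Fin 2) k⸨X⸩).det *
          ((g⁻¹ * g' : GL (Fin 2) k⸨X⸩) : Matrix (Fin 2) (Fin 2) k⸨X⸩).det := by
      rw [← Matrix.det_mul, ← Units.val_mul, ← hg]
    show (g : Matrix (Fin 2) (Fin 2) k⸨X⸩).det.order
      = (g' : Matrix (Fin 2) (Fin 2) k⸨X⸩).det.order
    rw [this, HahnSeries.order_mul (det_ne_zero_GL g) (det_ne_zero_GL (g⁻¹ * g')), h0, add_zero])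

/-- The map `H_G : 𝒳(k) → Λ_G → 𝔞_G^G` (the retraction `f_G` is the identity). -/
def HG (x : AffGr k) : Fin 2 → ℝ := latticeToAGG (nuG x)

/-- The polytope `Ec_G(x)`, the convex hull of the points `H_P(x)` for `P ∈ 𝒫(G) = {G}`. -/
def EcG (x : AffGr k) : Set (Fin 2 → ℝ) := convexHull ℝ {HG x}

/-- The weight factor `w_G^ξ([g])`: the number of integral points (points of the image of `Λ_G`
in `𝔞_G^G`) of the polytope `Ec_G([g]) - ξ`. -/
def weightG (ξ : aGG) (x : AffGr k) : ℕ∞ :=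
  Set.encard {v | v ∈ Set.range latticeToAGG ∧ v + (ξ : Fin 2 → ℝ) ∈ EcG x}

lemma latticeToAGG_eq_zero (l : ℤ) : latticeToAGG l = 0 := by
  ext i; simp [latticeToAGG, projAG, projG]

lemma weightG_eq (ξ : aGG) (x y : AffGr k) : weightG ξ x = weightG ξ y := by
  simp [weightG, EcG, HG, latticeToAGG_eq_zero]

end Weight

/-! ### Regular points and the fundamental domain -/

section Fundamental

variable {k : Type*} [Field k]

/-- A matrix over a field is regular in `𝔤𝔩₂` if its centralizer has the minimal dimension `2`. -/
def IsRegularMatrix (A : Matrix (Fin 2) (Fin 2) k) : Prop :=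
  Module.finrank k (Subalgebra.centralizer k ({A} : Set (Matrix (Fin 2) (Fin 2) k))) = 2

/-- `x = [g] ∈ 𝒳_γ` is regular if `Ad(g)⁻¹ γ ∈ 𝔤(𝒪)` has regular reduction in `𝔤(k)`. -/
def IsRegularPoint (γ : Matrix (Fin 2) (Fin 2) k⸨X⸩) (x : AffGr k) : Prop :=
  ∃ (g : GL (Fin 2) k⸨X⸩) (B : Matrix (Fin 2) (Fin 2) k⟦X⟧), x = cls k g ∧
    adInv g γ = B.map (incl k) ∧ IsRegularMatrix (B.map (PowerSeries.constantCoeff (R := k)))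

/-- The `k`-points of the fundamental domain `F_γ` attached to `x₀` (the case `M₀ = G`). -/
def fundamentalDomain (γ : Matrix (Fin 2) (Fin 2) k⸨X⸩) (x₀ : AffGr k) : Set (AffGr k) :=
  {x | x ∈ springerFiber γ ∧ EcG x ⊆ EcG x₀ ∧ nuG x = nuG x₀}

end Fundamental

/-! ### Orbital integrals -/

section Orbital

variable {k : Type*} [Field k]

/-- `GL₂(F)`, with the topology of the local field `F = k((ε))`, carries its Borel `σ`-algebra. -/
instance : MeasurableSpace (GL (Fin 2) k⸨X⸩) := borel _

instance : BorelSpace (GL (Fin 2) k⸨X⸩) := ⟨rfl⟩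

/-- The torus `T(F)`: the centralizer of `γ` in `GL₂(F)`. -/
def torus (γ : Matrix (Fin 2) (Fin 2) k⸨X⸩) : Subgroup (GL (Fin 2) k⸨X⸩) where
  carrier := {t | (t : Matrix (Fin 2) (Fin 2) k⸨X⸩) * γ = γ * (t : Matrix (Fin 2) (Fin 2) k⸨X⸩)}
  one_mem' := by simp
  mul_mem' := by
    intro a b ha hb
    simp only [Set.mem_ofPred_eq] at ha hb ⊢
    rw [Units.val_mul, mul_assoc, hb, ← mul_assoc, ha, mul_assoc]
  inv_mem' := by
    intro a ha
    simp only [Set.mem_ofPred_eq] at ha ⊢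
    exact (Units.inv_mul_eq_iff_eq_mul a).mpr
      (by rw [← mul_assoc, ha, mul_assoc, Units.mul_inv, mul_one])

/-- The quotient `T(F)\GL₂(F)`, with the quotient `σ`-algebra. -/
abbrev TorusQuotient (γ : Matrix (Fin 2) (Fin 2) k⸨X⸩) : Type _ :=
  Quotient (QuotientGroup.rightRel (torus γ))

/-- The class `T(F) g`. -/
abbrev tcls (γ : Matrix (Fin 2) (Fin 2) k⸨X⸩) (g : GL (Fin 2) k⸨X⸩) : TorusQuotient γ :=
  Quotient.mk _ g

/-- The measures entering the orbital integrals: Haar measures `dg` on `GL₂(F)` and `dt` on `T(F)`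
giving mass `1` to `GL₂(𝒪)` and to `T(𝒪) = T(F) ∩ GL₂(𝒪)`, and the quotient measure `dg/dt` on
`T(F)\GL₂(F)`, characterized by
`∫_{GL₂(F)} f(g) dg = ∫_{T(F)\GL₂(F)} (∫_{T(F)} f(tg) dt) dg/dt`. -/
structure OrbitalMeasures (γ : Matrix (Fin 2) (Fin 2) k⸨X⸩) where
  dg : Measure (GL (Fin 2) k⸨X⸩)
  dt : Measure (torus γ)
  quot : Measure (TorusQuotient γ)
  haar_dg : dg.IsHaarMeasure
  haar_dt : dt.IsHaarMeasure
  dg_arcGroup : dg (arcGroup k : Set (GL (Fin 2) k⸨X⸩)) = 1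
  dt_integral : dt {t | (t : GL (Fin 2) k⸨X⸩) ∈ arcGroup k} = 1
  quotient_formula : ∀ (f : GL (Fin 2) k⸨X⸩ → ℝ≥0∞) (Φ : TorusQuotient γ → ℝ≥0∞),
    Measurable f →
    (∀ g, Φ (tcls γ g) = ∫⁻ t : torus γ, f ((t : GL (Fin 2) k⸨X⸩) * g) ∂dt) →
    ∫⁻ g, f g ∂dg = ∫⁻ x, Φ x ∂quot

lemma adInv_torus_mul {γ : Matrix (Fin 2) (Fin 2) k⸨X⸩} {t : GL (Fin 2) k⸨X⸩}
    (ht : t ∈ torus γ) (g : GL (Fin 2) k⸨X⸩) : adInv (t * g) γ = adInv g γ := by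
  have h1 : (t : Matrix (Fin 2) (Fin 2) k⸨X⸩) * γ = γ * (t : Matrix (Fin 2) (Fin 2) k⸨X⸩) := ht
  have h2 : ((t⁻¹ : GL (Fin 2) k⸨X⸩) : Matrix (Fin 2) (Fin 2) k⸨X⸩) *
      (γ * (t : Matrix (Fin 2) (Fin 2) k⸨X⸩)) = γ := by
    rw [← h1]; exact Units.inv_mul_cancel_left t γ
  unfold adInv
  rw [_root_.mul_inv_rev, Units.val_mul, Units.val_mul]
  calc _ = ((g⁻¹ : GL (Fin 2) k⸨X⸩) : Matrix (Fin 2) (Fin 2) k⸨X⸩) *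
      (((t⁻¹ : GL (Fin 2) k⸨X⸩) : Matrix (Fin 2) (Fin 2) k⸨X⸩) *
      (γ * (t : Matrix (Fin 2) (Fin 2) k⸨X⸩))) * (g : Matrix (Fin 2) (Fin 2) k⸨X⸩) := by
        simp only [mul_assoc]
    _ = _ := by rw [h2]

open Classical in
/-- The function `T(F) g ↦ 𝟙_{𝔤(𝒪)}(Ad(g)⁻¹ γ)` on `T(F)\GL₂(F)`. -/
def orbitalIntegrand (γ : Matrix (Fin 2) (Fin 2) k⸨X⸩) : TorusQuotient γ → ℝ≥0∞ :=
  Quotient.lift (fun g : GL (Fin 2) k⸨X⸩ => if adInv g γ ∈ latticeGO k then 1 else 0) (by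
    intro g g' h
    have h' : g' * g⁻¹ ∈ torus γ := QuotientGroup.rightRel_apply.mp h
    have hg := adInv_torus_mul h' g
    rw [inv_mul_cancel_right] at hg
    show (if adInv g γ ∈ latticeGO k then (1 : ℝ≥0∞) else 0)
      = if adInv g' γ ∈ latticeGO k then 1 else 0
    rw [hg])

/-- The function `T(F) g ↦ w_G^ξ(g)` on `T(F)\GL₂(F)`. -/
def weightOnQuotient (γ : Matrix (Fin 2) (Fin 2) k⸨X⸩) (ξ : aGG) : TorusQuotient γ → ℝ≥0∞ :=
  Quotient.lift (fun g : GL (Fin 2) k⸨X⸩ => (weightG ξ (cls k g) : ℝ≥0∞))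
    (fun g g' _ => by
      show ((weightG ξ (cls k g) : ℕ∞) : ℝ≥0∞) = (weightG ξ (cls k g') : ℕ∞)
      rw [weightG_eq ξ (cls k g) (cls k g')])

/-- The orbital integral `I_γ^G = ∫_{T(F)\GL₂(F)} 𝟙_{𝔤(𝒪)}(Ad(g)⁻¹ γ) dg/dt`. -/
def orbitalIntegral {γ : Matrix (Fin 2) (Fin 2) k⸨X⸩} (m : OrbitalMeasures γ) : ℝ≥0∞ :=
  ∫⁻ x, orbitalIntegrand γ x ∂m.quot

/-- The weighted orbital integral
`J_G^ξ(γ) = ∫_{T(F)\GL₂(F)} 𝟙_{𝔤(𝒪)}(Ad(g)⁻¹ γ) w_G^ξ(g) dg/dt`. -/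
def weightedOrbitalIntegral {γ : Matrix (Fin 2) (Fin 2) k⸨X⸩} (m : OrbitalMeasures γ)
    (ξ : aGG) : ℝ≥0∞ :=
  ∫⁻ x, orbitalIntegrand γ x * weightOnQuotient γ ξ x ∂m.quot

end Orbital

end GL2Springer

end

/-!
An element of the Iwahori subgroup conjugates `γ` into a matrix of the same shape: the off-diagonal
entries are units times `εⁿ` and `εⁿ⁺¹`, and the diagonal entries are integral
(`exists_adInv_iwahori`). Conjugation by `diag(ε^a₁, ε^a₂)` then multiplies the off-diagonal entries
by `ε^(a₂ - a₁)` and `ε^(a₁ - a₂)`, which gives the description of the affine Springer fiber on the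
Iwahori orbits over any nonzero ring.

For the integrals, `T(F)` is the multiplicative group of the ramified quadratic extension `F(√ε)`.
The norm form `x² - ε y²` is anisotropic without cancellation between its two terms
(`coeff_sq_sub_eq_zero_iff`), so `T(𝒪)` is the kernel of `val ∘ det` on `T(F)`, while
`[[0, 1], [ε, 0]]` in `T(F)` has `val ∘ det = 1`. Hence the open set `G₀ = {val (det g) = 0}` meets
every coset `T(F) g` in a translate of `T(𝒪)`, of volume `1`. Therefore the image of `dg` restricted
to `G₀` is a quotient measure (`exists_orbitalMeasures`), and for every quotient measure the
orbital integral is the volume of the part of `G₀` lying over `𝒳_γ`, that is the number of points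
of `𝒳_γ` with `ν_G = 0` (`orbitalIntegral_eq_ncard`). The space `𝔞_G^G` is zero, so the weights
are all `1`, and every fundamental domain is a level set of `ν_G` on `𝒳_γ`, a translate of the
level `0`.

The points with `ν_G = 0` are counted by the Iwasawa decomposition. Each of them is the class of
`[[1, u], [0, 1]] · diag(ε^a, ε^(-a))`, with `a` unique and `u` unique modulo `ε^(2a)`
(`cls_iwasawaRep_eq_iff`), and it lies in `𝒳_γ` exactly when `-(n + 1) ≤ 2a ≤ n` and `u` has
no terms below degree `a - ⌊(n + 1) / 2⌋` (`iwasawaRep_mem_springerFiber_iff`). This leaves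
`i = a + ⌊(n + 1) / 2⌋` free coefficients, and `i` runs through `0, …, n`, each value once.
-/

noncomputable section

namespace GL2Springer

/-! ### Integrality of Laurent series and of matrices -/

section Integrality

variable {R : Type*} [CommRing R]

lemma mem_range_incl_iff {x : R⸨X⸩} : x ∈ (incl R).range ↔ ∀ m < 0, x.coeff m = 0 := by
  constructor
  · rintro ⟨f, rfl⟩ m hm
    exact (PowerSeries.coeff_coe f m).trans (if_pos hm)
  · intro h
    refine ⟨PowerSeries.mk fun m => x.coeff m, ?_⟩
    ext m
    refine (PowerSeries.coeff_coe _ m).trans ?_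
    split_ifs with hm
    · exact (h m hm).symm
    · rw [PowerSeries.coeff_mk, Int.natAbs_of_nonneg (not_lt.mp hm)]

lemma incl_injective : Function.Injective (incl R) := HahnSeries.ofPowerSeries_injective

lemma coeff_single_one_mul (m j : ℤ) (x : R⸨X⸩) :
    (HahnSeries.single m 1 * x).coeff j = x.coeff (j - m) := by
  have := HahnSeries.coeff_single_mul_add (r := (1 : R)) (x := x) (a := j - m) (b := m)
  simpa using this

lemma single_mul_mem_range_incl_iff {m : ℤ} {x : R⸨X⸩} :
    HahnSeries.single m 1 * x ∈ (incl R).range ↔ ∀ j < -m, x.coeff j = 0 := by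
  rw [mem_range_incl_iff]
  constructor
  · intro h j hj
    have := h (j + m) (by omega)
    rwa [coeff_single_one_mul, add_sub_cancel_right] at this
  · intro h j hj
    rw [coeff_single_one_mul]
    exact h _ (by omega)

lemma incl_X_pow_mul (n : ℕ) (f : R⟦X⟧) :
    incl R (PowerSeries.X ^ n * f) = HahnSeries.single (n : ℤ) 1 * incl R f := by
  rw [map_mul, HahnSeries.ofPowerSeries_X_pow]

/-- For a power series `u` with invertible constant term, `ε^m · ε^n u` is integral exactly when
`0 ≤ m + n`. -/
lemma single_mul_incl_mem_range_iff [Nontrivial R] {u : R⟦X⟧} (hu : IsUnit u) (m : ℤ) (n : ℕ) :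
    HahnSeries.single m 1 * incl R (PowerSeries.X ^ n * u) ∈ (incl R).range ↔ 0 ≤ m + n := by
  rw [incl_X_pow_mul, ← mul_assoc, HahnSeries.single_mul_single, mul_one,
    single_mul_mem_range_incl_iff]
  constructor
  · intro h
    by_contra! hlt
    have h0 := h 0 (by omega)
    have h1 := (PowerSeries.coeff_coe u 0).symm.trans h0
    rw [if_neg (lt_irrefl _), Int.natAbs_zero, PowerSeries.coeff_zero_eq_constantCoeff_apply] at h1
    exact (hu.map PowerSeries.constantCoeff).ne_zero h1
  · intro h j hj
    exact mem_range_incl_iff.mp ⟨u, rfl⟩ j (by omega)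

lemma single_mul_incl_mem_range (u : R⟦X⟧) {m : ℤ} {n : ℕ} (h : 0 ≤ m + n) :
    HahnSeries.single m 1 * incl R (PowerSeries.X ^ n * u) ∈ (incl R).range := by
  rw [incl_X_pow_mul, ← mul_assoc, HahnSeries.single_mul_single, mul_one,
    single_mul_mem_range_incl_iff]
  intro j hj
  exact mem_range_incl_iff.mp ⟨u, rfl⟩ j (by omega)

lemma mem_latticeGO_iff {A : Matrix (Fin 2) (Fin 2) R⸨X⸩} :
    A ∈ latticeGO R ↔ ∀ i j, A i j ∈ (incl R).range := by
  constructor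
  · rintro ⟨B, rfl⟩ i j
    exact ⟨B i j, rfl⟩
  · intro h
    choose B hB using h
    exact ⟨Matrix.of B, Matrix.ext hB⟩

lemma mul_mem_latticeGO {A B : Matrix (Fin 2) (Fin 2) R⸨X⸩} (hA : A ∈ latticeGO R)
    (hB : B ∈ latticeGO R) : A * B ∈ latticeGO R := by
  obtain ⟨A, rfl⟩ := hA
  obtain ⟨B, rfl⟩ := hB
  exact ⟨A * B, Matrix.map_mul⟩

lemma coe_mem_latticeGO {g : GL (Fin 2) R⸨X⸩} (hg : g ∈ arcGroup R) :
    (g : Matrix (Fin 2) (Fin 2) R⸨X⸩) ∈ latticeGO R := by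
  obtain ⟨κ, rfl⟩ := hg
  exact ⟨κ, rfl⟩

lemma mem_arcGroup_of_isUnit_det {g : GL (Fin 2) R⸨X⸩} {A : Matrix (Fin 2) (Fin 2) R⟦X⟧}
    (hA : (g : Matrix (Fin 2) (Fin 2) R⸨X⸩) = A.map (incl R)) (hdet : IsUnit A.det) :
    g ∈ arcGroup R := by
  obtain ⟨κ, hκ⟩ := (Matrix.isUnit_iff_isUnit_det A).mpr hdet
  refine ⟨κ, Units.ext ?_⟩
  rw [hA, ← hκ]
  rfl

lemma mem_arcGroup_iff {g : GL (Fin 2) R⸨X⸩} : g ∈ arcGroup R ↔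
    (g : Matrix (Fin 2) (Fin 2) R⸨X⸩) ∈ latticeGO R ∧
      (↑g⁻¹ : Matrix (Fin 2) (Fin 2) R⸨X⸩) ∈ latticeGO R := by
  refine ⟨fun h => ⟨coe_mem_latticeGO h, coe_mem_latticeGO (inv_mem h)⟩, ?_⟩
  rintro ⟨⟨A, hA⟩, ⟨B, hB⟩⟩
  refine mem_arcGroup_of_isUnit_det hA.symm (IsUnit.of_mul_eq_one B.det ?_)
  rw [← Matrix.det_mul]
  apply incl_injective
  rw [RingHom.map_det, map_mul, map_one]
  have hA' : (incl R).mapMatrix A = g := hA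
  have hB' : (incl R).mapMatrix B = ↑g⁻¹ := hB
  rw [hA', hB', ← Units.val_mul, mul_inv_cancel, Units.val_one, Matrix.det_one]

lemma adInv_mul (g h : GL (Fin 2) R⸨X⸩) (A : Matrix (Fin 2) (Fin 2) R⸨X⸩) :
    adInv (g * h) A = adInv h (adInv g A) := by
  simp only [adInv, _root_.mul_inv_rev, Units.val_mul, mul_assoc]

lemma adInv_mem_latticeGO_of_mem_arcGroup {h : GL (Fin 2) R⸨X⸩} (hh : h ∈ arcGroup R)
    {A : Matrix (Fin 2) (Fin 2) R⸨X⸩} (hA : A ∈ latticeGO R) : adInv h A ∈ latticeGO R :=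
  mul_mem_latticeGO (mul_mem_latticeGO (coe_mem_latticeGO (inv_mem hh)) hA) (coe_mem_latticeGO hh)

lemma cls_eq_cls_iff {g h : GL (Fin 2) R⸨X⸩} : cls R g = cls R h ↔ g⁻¹ * h ∈ arcGroup R :=
  QuotientGroup.eq

lemma cls_mem_springerFiber_iff {γ : Matrix (Fin 2) (Fin 2) R⸨X⸩} {g : GL (Fin 2) R⸨X⸩} :
    cls R g ∈ springerFiber γ ↔ adInv g γ ∈ latticeGO R := by
  refine ⟨?_, fun h => ⟨g, rfl, h⟩⟩
  rintro ⟨h, hgh, hh⟩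
  have := adInv_mem_latticeGO_of_mem_arcGroup (cls_eq_cls_iff.mp hgh.symm) hh
  rwa [← adInv_mul, mul_inv_cancel_left] at this

lemma adInv_epsDiag (a₁ a₂ : ℤ) (A : Matrix (Fin 2) (Fin 2) R⸨X⸩) :
    adInv (epsDiag R a₁ a₂) A =
      !![A 0 0, HahnSeries.single (a₂ - a₁) 1 * A 0 1;
        HahnSeries.single (a₁ - a₂) 1 * A 1 0, A 1 1] := by
  have h : adInv (epsDiag R a₁ a₂) A =
      !![HahnSeries.single (-a₁) 1, 0; 0, HahnSeries.single (-a₂) 1] * A *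
        !![HahnSeries.single a₁ 1, 0; 0, HahnSeries.single a₂ 1] := rfl
  rw [h, Matrix.eta_fin_two A]
  have key : ∀ (a b : ℤ) (x : R⸨X⸩),
      HahnSeries.single a 1 * x * HahnSeries.single b 1 = HahnSeries.single (b + a) 1 * x := by
    intro a b x
    rw [mul_right_comm, HahnSeries.single_mul_single, mul_one, add_comm]
  ext i j : 1
  fin_cases i <;> fin_cases j <;>
    simp [Matrix.mul_apply, Fin.sum_univ_two, key, sub_eq_add_neg]

end Integrality

/-! ### Iwahori orbits -/

section Iwahori

variable {R : Type*} [CommRing R]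

/-- Conjugation by the Iwahori subgroup keeps the shape of `γ`: the off-diagonal entries stay unit
multiples of `εⁿ` and `εⁿ⁺¹`. The reason is that `[[0, 1], [ε, 0]]` normalizes the Iwahori
subgroup. -/
lemma exists_adInv_iwahori {b : R⟦X⟧} (hb : IsUnit b) (n : ℕ) {i : GL (Fin 2) R⸨X⸩}
    (hi : i ∈ iwahori R) : ∃ u v d : R⟦X⟧, IsUnit u ∧ IsUnit v ∧
      adInv i (ramifiedGamma b n) = (!![d, PowerSeries.X ^ n * u;
        PowerSeries.X ^ (n + 1) * v, -d] : Matrix (Fin 2) (Fin 2) R⟦X⟧).map (incl R) := by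
  obtain ⟨κ, hκ, rfl⟩ := hi
  have hr : PowerSeries.constantCoeff ((κ : Matrix (Fin 2) (Fin 2) R⟦X⟧) 1 0) = 0 := hκ
  obtain ⟨r, hr⟩ := PowerSeries.X_dvd_iff.mpr hr
  set p := (κ : Matrix (Fin 2) (Fin 2) R⟦X⟧) 0 0 with hp
  set q := (κ : Matrix (Fin 2) (Fin 2) R⟦X⟧) 0 1 with hq
  set s := (κ : Matrix (Fin 2) (Fin 2) R⟦X⟧) 1 1 with hs
  have hdet : (κ : Matrix (Fin 2) (Fin 2) R⟦X⟧).det = p * s - q * (PowerSeries.X * r) := by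
    rw [Matrix.det_fin_two, hr]
  have hD : IsUnit (κ : Matrix (Fin 2) (Fin 2) R⟦X⟧).det :=
    (Matrix.isUnit_iff_isUnit_det _).mp κ.isUnit
  have hps : IsUnit (PowerSeries.constantCoeff p * PowerSeries.constantCoeff s) := by
    have := hD.map (PowerSeries.constantCoeff (R := R))
    rw [hdet] at this
    simpa using this
  have hpu := isUnit_of_mul_isUnit_left hps
  have hsu := isUnit_of_mul_isUnit_right hps
  have hu : IsUnit (s ^ 2 - PowerSeries.X * q ^ 2) := by
    rw [PowerSeries.isUnit_iff_constantCoeff]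
    simpa using hsu.pow 2
  have hv : IsUnit (p ^ 2 - PowerSeries.X * r ^ 2) := by
    rw [PowerSeries.isUnit_iff_constantCoeff]
    simpa using hpu.pow 2
  set D := Ring.inverse (κ : Matrix (Fin 2) (Fin 2) R⟦X⟧).det with hDdef
  have hDu : IsUnit D := hD.ringInverse
  refine ⟨D * b * (s ^ 2 - PowerSeries.X * q ^ 2), D * b * (p ^ 2 - PowerSeries.X * r ^ 2),
    D * b * PowerSeries.X ^ (n + 1) * (r * s - p * q), (hDu.mul hb).mul hu, (hDu.mul hb).mul hv, ?_⟩
  have h : adInv (GeneralLinearGroup.map (n := Fin 2) (incl R) κ) (ramifiedGamma b n) =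
      ((↑κ⁻¹ : Matrix (Fin 2) (Fin 2) R⟦X⟧) *
        !![0, b * PowerSeries.X ^ n; b * PowerSeries.X ^ (n + 1), 0] *
        (κ : Matrix (Fin 2) (Fin 2) R⟦X⟧)).map (incl R) := by
    rw [Matrix.map_mul, Matrix.map_mul]
    rfl
  rw [h, Matrix.coe_units_inv, Matrix.inv_def, ← hDdef, Matrix.adjugate_fin_two,
    Matrix.eta_fin_two (κ : Matrix (Fin 2) (Fin 2) R⟦X⟧), ← hp, ← hq, ← hs, hr]
  congr 1
  ext i j : 1
  fin_cases i <;> fin_cases j <;>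
    simp [Matrix.mul_apply, Fin.sum_univ_two] <;> ring

lemma mem_springerFiber_of_mem_iwahoriOrbit {b : R⟦X⟧} (hb : IsUnit b) {n : ℕ} {a₁ a₂ : ℤ}
    (h : -((n : ℤ) + 1) ≤ a₁ - a₂ ∧ a₁ - a₂ ≤ n) {x : AffGr R} (hx : x ∈ iwahoriOrbit R a₁ a₂) :
    x ∈ springerFiber (ramifiedGamma b n) := by
  obtain ⟨i, hi, rfl⟩ := hx
  obtain ⟨u, v, d, -, -, heq⟩ := exists_adInv_iwahori hb n hi
  rw [cls_mem_springerFiber_iff, adInv_mul, heq, adInv_epsDiag, mem_latticeGO_iff]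
  intro i j
  fin_cases i <;> fin_cases j
  · exact ⟨_, rfl⟩
  · exact single_mul_incl_mem_range u (by omega)
  · exact single_mul_incl_mem_range v (by push_cast; omega)
  · exact ⟨_, rfl⟩

lemma bounds_of_mem_springerFiber_of_mem_iwahoriOrbit [Nontrivial R] {b : R⟦X⟧} (hb : IsUnit b)
    {n : ℕ} {a₁ a₂ : ℤ} {x : AffGr R} (hx : x ∈ iwahoriOrbit R a₁ a₂)
    (hx' : x ∈ springerFiber (ramifiedGamma b n)) :
    -((n : ℤ) + 1) ≤ a₁ - a₂ ∧ a₁ - a₂ ≤ n := by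
  obtain ⟨i, hi, rfl⟩ := hx
  obtain ⟨u, v, d, hu, hv, heq⟩ := exists_adInv_iwahori hb n hi
  rw [cls_mem_springerFiber_iff, adInv_mul, heq, adInv_epsDiag, mem_latticeGO_iff] at hx'
  have h1 := (single_mul_incl_mem_range_iff hu (a₂ - a₁) n).mp (hx' 0 1)
  have h2 := (single_mul_incl_mem_range_iff hv (a₁ - a₂) (n + 1)).mp (hx' 1 0)
  push_cast at h2
  omega

end Iwahori

/-! ### The topology of `k((ε))` and of `GL₂(k((ε)))` -/

section Topology

open Topology

variable {k : Type*} [Field k]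

/-- The `ε`-adic neighbourhoods `x + ε^D k⟦ε⟧`. -/
lemma hasBasis_nhds_laurent (x : k⸨X⸩) :
    (𝓝 x).HasBasis (fun _ : ℤ => True) fun D => {y | ∀ j < D, (y - x).coeff j = 0} := by
  refine ⟨fun s => ?_⟩
  rw [Valued.mem_nhds]
  constructor
  · rintro ⟨γ, hγ⟩
    have hne : MonoidWithZeroHom.ValueGroup₀.embedding γ.1 ≠ 0 := by
      simp
    refine ⟨1 - WithZero.log (MonoidWithZeroHom.ValueGroup₀.embedding γ.1), trivial,
      fun y hy => hγ ?_⟩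
    rw [Set.mem_ofPred_eq, Valuation.restrict_lt_iff_lt_embedding]
    refine lt_of_le_of_lt ((LaurentSeries.valuation_le_iff_coeff_lt_eq_zero k).mpr hy) ?_
    rw [← WithZero.lt_log_iff_exp_lt hne]
    omega
  · rintro ⟨D, -, hD⟩
    have hne : (Valued.v (R := k⸨X⸩)).restrict (HahnSeries.single (D - 1) 1) ≠ 0 := by
      simp
    refine ⟨Units.mk0 _ hne, fun y hy => hD ?_⟩
    rw [Set.mem_ofPred_eq, Units.val_mk0, Valuation.restrict_lt_iff,
      LaurentSeries.valuation_single_zpow] at hy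
    refine (LaurentSeries.valuation_le_iff_coeff_lt_eq_zero k).mp ?_
    by_cases h0 : Valued.v (y - x) = 0
    · rw [h0]; exact zero_le
    · rw [← WithZero.log_le_iff_le_exp h0]
      have := (WithZero.log_lt_iff_lt_exp h0).mpr hy
      omega

lemma isOpen_range_incl : IsOpen ((incl k).range : Set k⸨X⸩) := by
  rw [isOpen_iff_mem_nhds]
  intro x hx
  refine (hasBasis_nhds_laurent x).mem_iff.mpr ⟨0, trivial, fun y hy => ?_⟩
  have : y - x ∈ (incl k).range := mem_range_incl_iff.mpr hy
  simpa using add_mem this hx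

/-- `k⟦ε⟧` is compact for finite `k`: it is the continuous image of the space of coefficient
sequences. -/
lemma isCompact_range_incl [Finite k] : IsCompact ((incl k).range : Set k⸨X⸩) := by
  let : TopologicalSpace k := ⊥
  have : DiscreteTopology k := ⟨rfl⟩
  have hcont : Continuous fun c : ℕ → k => incl k (PowerSeries.mk c) := by
    rw [continuous_iff_continuousAt]
    intro c
    refine (hasBasis_nhds_laurent _).tendsto_right_iff.mpr fun D _ => ?_
    have hfin : (Set.Iio D.toNat).Finite := Set.finite_Iio _
    have hev : ∀ᶠ c' : ℕ → k in 𝓝 c, ∀ i ∈ Set.Iio D.toNat, c' i = c i := by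
      rw [Filter.eventually_all_finite hfin]
      intro i _
      exact (continuous_apply i).continuousAt.eventually_mem
        ((isOpen_discrete {c i}).mem_nhds rfl)
    filter_upwards [hev] with c' hc' j hj
    rw [← map_sub]
    refine (PowerSeries.coeff_coe _ j).trans ?_
    split_ifs with h
    · rfl
    · rw [map_sub, PowerSeries.coeff_mk, PowerSeries.coeff_mk,
        hc' _ (by rw [Set.mem_Iio]; omega), sub_self]
  have := isCompact_range hcont
  convert this using 1
  ext x
  constructor
  · rintro ⟨f, rfl⟩
    exact ⟨fun i => PowerSeries.coeff i f, congrArg _ (PowerSeries.ext fun i => by simp)⟩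
  · rintro ⟨c, rfl⟩
    exact ⟨_, rfl⟩

/-- `k((ε))` is pseudometrizable and the union of the compact sets `ε^(-N) k⟦ε⟧`. -/
instance [Finite k] : SecondCountableTopology k⸨X⸩ := by
  have : (𝓝 (0 : k⸨X⸩)).IsCountablyGenerated :=
    (hasBasis_nhds_laurent (0 : k⸨X⸩)).isCountablyGenerated
  have := IsUniformAddGroup.uniformity_countably_generated (α := k⸨X⸩)
  have : SigmaCompactSpace k⸨X⸩ := by
    refine ⟨⟨fun N => (fun x => HahnSeries.single (-(N : ℤ)) 1 * x) '' (incl k).range,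
      fun N => isCompact_range_incl.image (continuous_const.mul continuous_id), ?_⟩⟩
    refine Set.eq_univ_of_forall fun x => Set.mem_iUnion.mpr
      ⟨(-x.order).toNat, HahnSeries.single ((-x.order).toNat : ℤ) 1 * x, ?_, ?_⟩
    · refine single_mul_mem_range_incl_iff.mpr fun j hj => ?_
      exact HahnSeries.coeff_eq_zero_of_lt_order (by omega)
    · show HahnSeries.single _ 1 * (HahnSeries.single _ 1 * x) = x
      rw [← mul_assoc, HahnSeries.single_mul_single]
      simp
  let := UniformSpace.pseudoMetricSpace k⸨X⸩
  infer_instance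

lemma isOpen_latticeGO : IsOpen (latticeGO k) := by
  have : latticeGO k = ⋂ i, ⋂ j, (fun A : Matrix (Fin 2) (Fin 2) k⸨X⸩ => A i j) ⁻¹'
      ((incl k).range : Set k⸨X⸩) := by
    ext A; simp only [mem_latticeGO_iff, Set.mem_iInter, Set.mem_preimage]; rfl
  rw [this]
  exact isOpen_iInter_of_finite fun i => isOpen_iInter_of_finite fun j =>
    isOpen_range_incl.preimage (continuous_id.matrix_elem i j)

lemma isCompact_latticeGO [Finite k] : IsCompact (latticeGO k) := by
  have h := isCompact_univ_pi fun _ : Fin 2 => isCompact_univ_pi fun _ : Fin 2 =>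
    isCompact_range_incl (k := k)
  have heq : latticeGO k = (Set.univ.pi fun _ : Fin 2 => Set.univ.pi fun _ : Fin 2 =>
      ((incl k).range : Set k⸨X⸩) : Set (Fin 2 → Fin 2 → k⸨X⸩)) := by
    refine Set.ext fun A => mem_latticeGO_iff.trans ?_
    exact ⟨fun h i _ j _ => h i j, fun h i j => h i trivial j trivial⟩
  rw [heq]
  exact h

lemma isOpen_arcGroup : IsOpen (arcGroup k : Set (GL (Fin 2) k⸨X⸩)) := by
  have : (arcGroup k : Set (GL (Fin 2) k⸨X⸩)) =
      (fun g : GL (Fin 2) k⸨X⸩ => (g : Matrix (Fin 2) (Fin 2) k⸨X⸩)) ⁻¹' latticeGO k ∩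
      (fun g : GL (Fin 2) k⸨X⸩ => (↑g⁻¹ : Matrix (Fin 2) (Fin 2) k⸨X⸩)) ⁻¹' latticeGO k := by
    ext g; exact mem_arcGroup_iff
  rw [this]
  exact (isOpen_latticeGO.preimage Units.continuous_val).inter
    (isOpen_latticeGO.preimage Units.continuous_coe_inv)

lemma isCompact_arcGroup [Finite k] : IsCompact (arcGroup k : Set (GL (Fin 2) k⸨X⸩)) := by
  have h := (Units.isClosedEmbedding_embedProduct
    (α := Matrix (Fin 2) (Fin 2) k⸨X⸩)).isCompact_preimage
    ((isCompact_latticeGO (k := k)).prod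
      (MulOpposite.opHomeomorph.symm.isCompact_preimage.mpr (isCompact_latticeGO (k := k))))
  convert h using 1
  ext g
  exact mem_arcGroup_iff

instance [Finite k] : SecondCountableTopology (GL (Fin 2) k⸨X⸩) := by
  have : SecondCountableTopology (Matrix (Fin 2) (Fin 2) k⸨X⸩) :=
    inferInstanceAs (SecondCountableTopology (Fin 2 → Fin 2 → k⸨X⸩))
  have : SecondCountableTopology (Matrix (Fin 2) (Fin 2) k⸨X⸩)ᵐᵒᵖ :=
    MulOpposite.opHomeomorph.symm.isEmbedding.secondCountableTopology
  exact Units.isEmbedding_embedProduct.secondCountableTopology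

/-- `GL₂(k⟦ε⟧)` is a compact neighbourhood of `1`. -/
instance [Finite k] : LocallyCompactSpace (GL (Fin 2) k⸨X⸩) :=
  isCompact_arcGroup.locallyCompactSpace_of_mem_nhds_of_group
    (isOpen_arcGroup.mem_nhds (one_mem (arcGroup k)))

lemma isClosed_torus (γ : Matrix (Fin 2) (Fin 2) k⸨X⸩) :
    IsClosed (torus γ : Set (GL (Fin 2) k⸨X⸩)) :=
  isClosed_eq (Units.continuous_val.mul continuous_const)
    (continuous_const.mul Units.continuous_val)

instance [Finite k] (γ : Matrix (Fin 2) (Fin 2) k⸨X⸩) : LocallyCompactSpace (torus γ) :=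
  (isClosed_torus γ).isClosedEmbedding_subtypeVal.locallyCompactSpace

/-- Preimages in `GL₂(k((ε)))` of sets of cosets of `GL₂(k⟦ε⟧)` are open. -/
lemma isOpen_preimage_cls (s : Set (AffGr k)) : IsOpen (cls k ⁻¹' s) := by
  have : DiscreteTopology (AffGr k) := QuotientGroup.discreteTopology isOpen_arcGroup
  exact (isOpen_discrete s).preimage QuotientGroup.continuous_mk

end Topology

/-! ### The torus `T(F)` -/

section Torus

variable {k : Type*} [Field k]

/-- The norm form `x² - ε y²` of the ramified quadratic extension `F(√ε)` is anisotropic, and the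
two terms never cancel since their valuations have different parities. -/
lemma coeff_sq_sub_eq_zero_iff (x y : k⸨X⸩) (m : ℤ) :
    (∀ j < m, (x ^ 2 - HahnSeries.single 1 1 * y ^ 2).coeff j = 0) ↔
      (∀ j, 2 * j < m → x.coeff j = 0) ∧ (∀ j, 2 * j + 1 < m → y.coeff j = 0) := by
  have hlow : ∀ (z : k⸨X⸩) (j : ℤ), j < 2 * z.order → (z ^ 2).coeff j = 0 := by
    intro z j hj
    by_cases hz : z = 0
    · simp [hz]
    · refine HahnSeries.coeff_eq_zero_of_lt_order ?_
      rw [pow_two, HahnSeries.order_mul hz hz]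
      omega
  have hlead : ∀ z : k⸨X⸩, z ≠ 0 → (z ^ 2).coeff (2 * z.order) ≠ 0 := by
    intro z hz
    rw [pow_two, two_mul, HahnSeries.coeff_mul_order_add_order]
    simp [hz]
  constructor
  · intro h
    have hx : x ≠ 0 → m ≤ 2 * x.order ∨ (y ≠ 0 ∧ y.order < x.order) := by
      intro hx
      by_contra! hcon
      have h1 := h (2 * x.order) hcon.1
      rw [HahnSeries.coeff_sub, coeff_single_one_mul] at h1
      have h2 : (y ^ 2).coeff (2 * x.order - 1) = 0 := by
        by_cases hy : y = 0
        · simp [hy]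
        · exact hlow y _ (by have := hcon.2 hy; omega)
      rw [h2, sub_zero] at h1
      exact hlead x hx h1
    have hy : y ≠ 0 → m ≤ 2 * y.order + 1 ∨ (x ≠ 0 ∧ x.order ≤ y.order) := by
      intro hy
      by_contra! hcon
      have h1 := h (2 * y.order + 1) hcon.1
      rw [HahnSeries.coeff_sub, coeff_single_one_mul, add_sub_cancel_right] at h1
      have h2 : (x ^ 2).coeff (2 * y.order + 1) = 0 := by
        by_cases hx : x = 0
        · simp [hx]
        · exact hlow x _ (by have := hcon.2 hx; omega)
      rw [h2, zero_sub, neg_eq_zero] at h1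
      exact hlead y hy h1
    constructor
    · intro j hj
      by_cases hx0 : x = 0
      · simp [hx0]
      · refine HahnSeries.coeff_eq_zero_of_lt_order ?_
        rcases hx hx0 with h1 | ⟨hy0, h1⟩
        · omega
        · rcases hy hy0 with h2 | ⟨-, h2⟩ <;> omega
    · intro j hj
      by_cases hy0 : y = 0
      · simp [hy0]
      · refine HahnSeries.coeff_eq_zero_of_lt_order ?_
        rcases hy hy0 with h1 | ⟨hx0, h1⟩
        · omega
        · rcases hx hx0 with h2 | ⟨-, h2⟩ <;> omega
  · rintro ⟨hx, hy⟩ j hj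
    have hx' : x ≠ 0 → m ≤ 2 * x.order := fun h0 => by
      by_contra! hlt
      exact h0 (HahnSeries.coeff_order_eq_zero.mp (hx _ hlt))
    have hy' : y ≠ 0 → m ≤ 2 * y.order + 1 := fun h0 => by
      by_contra! hlt
      exact h0 (HahnSeries.coeff_order_eq_zero.mp (hy _ hlt))
    rw [HahnSeries.coeff_sub, coeff_single_one_mul]
    have h1 : (x ^ 2).coeff j = 0 := by
      by_cases h0 : x = 0
      · simp [h0]
      · exact hlow x _ (by have := hx' h0; omega)
    have h2 : (y ^ 2).coeff (j - 1) = 0 := by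
      by_cases h0 : y = 0
      · simp [h0]
      · exact hlow y _ (by have := hy' h0; omega)
    rw [h1, h2, sub_zero]

lemma nuG_cls (g : GL (Fin 2) k⸨X⸩) :
    nuG (cls k g) = (g : Matrix (Fin 2) (Fin 2) k⸨X⸩).det.order := rfl

lemma nuG_mul (g h : GL (Fin 2) k⸨X⸩) : nuG (cls k (g * h)) = nuG (cls k g) + nuG (cls k h) := by
  rw [nuG_cls, nuG_cls, nuG_cls, Units.val_mul, Matrix.det_mul,
    HahnSeries.order_mul (det_ne_zero_GL g) (det_ne_zero_GL h)]

lemma nuG_one : nuG (cls k 1) = 0 := order_det_of_mem_arcGroup (one_mem _)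

lemma nuG_inv (g : GL (Fin 2) k⸨X⸩) : nuG (cls k g⁻¹) = -nuG (cls k g) := by
  have := nuG_mul g g⁻¹
  rw [mul_inv_cancel, nuG_one] at this
  omega

/-- `ν_G` as a homomorphism `GL₂(F) → ℤ`. -/
def valDet : GL (Fin 2) k⸨X⸩ →* Multiplicative ℤ where
  toFun g := Multiplicative.ofAdd (nuG (cls k g))
  map_one' := by rw [nuG_one]; rfl
  map_mul' g h := by rw [nuG_mul]; rfl

lemma nuG_zpow (g : GL (Fin 2) k⸨X⸩) (m : ℤ) : nuG (cls k (g ^ m)) = m * nuG (cls k g) := by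
  have := congrArg Multiplicative.toAdd (map_zpow (valDet (k := k)) g m)
  simpa [valDet] using this

lemma mem_arcGroup_iff_nuG {g : GL (Fin 2) k⸨X⸩} : g ∈ arcGroup k ↔
    (g : Matrix (Fin 2) (Fin 2) k⸨X⸩) ∈ latticeGO k ∧ nuG (cls k g) = 0 := by
  refine ⟨fun h => ⟨coe_mem_latticeGO h, order_det_of_mem_arcGroup h⟩, ?_⟩
  rintro ⟨⟨A, hA⟩, h0⟩
  refine mem_arcGroup_of_isUnit_det hA.symm ?_
  rw [nuG_cls] at h0
  have hdet : (g : Matrix (Fin 2) (Fin 2) k⸨X⸩).det = incl k A.det := by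
    rw [RingHom.map_det, ← hA]; rfl
  rw [PowerSeries.isUnit_iff_constantCoeff, isUnit_iff_ne_zero]
  have hne := mt HahnSeries.coeff_order_eq_zero.mp (det_ne_zero_GL g)
  rw [h0, hdet] at hne
  intro hc
  refine hne ((PowerSeries.coeff_coe A.det 0).trans ?_)
  simpa using hc

lemma nuG_epsDiag (a₁ a₂ : ℤ) : nuG (cls k (epsDiag k a₁ a₂)) = a₁ + a₂ := by
  rw [nuG_cls]
  show (!![HahnSeries.single a₁ 1, 0; 0, HahnSeries.single a₂ 1] :
    Matrix (Fin 2) (Fin 2) k⸨X⸩).det.order = _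
  rw [Matrix.det_fin_two_of, HahnSeries.single_mul_single]
  simp [HahnSeries.order_single]

lemma ramifiedGamma_eq (b : k⟦X⟧) (n : ℕ) : ramifiedGamma b n =
    !![0, incl k (b * PowerSeries.X ^ n);
      HahnSeries.single 1 1 * incl k (b * PowerSeries.X ^ n), 0] := by
  unfold ramifiedGamma
  ext i j : 1
  fin_cases i <;> fin_cases j
  · simp
  · simp
  · show incl k (b * PowerSeries.X ^ (n + 1)) = HahnSeries.single 1 1 * incl k _
    rw [pow_succ, ← mul_assoc, map_mul, HahnSeries.ofPowerSeries_X, mul_comm]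
  · simp

lemma mem_torus_iff {b : k⟦X⟧} (hb : IsUnit b) {n : ℕ} {t : GL (Fin 2) k⸨X⸩} :
    t ∈ torus (ramifiedGamma b n) ↔
      (t : Matrix (Fin 2) (Fin 2) k⸨X⸩) 1 1 = (t : Matrix (Fin 2) (Fin 2) k⸨X⸩) 0 0 ∧
      (t : Matrix (Fin 2) (Fin 2) k⸨X⸩) 1 0 =
        HahnSeries.single 1 1 * (t : Matrix (Fin 2) (Fin 2) k⸨X⸩) 0 1 := by
  have hne : incl k (b * PowerSeries.X ^ n) ≠ 0 := by
    rw [Ne, map_eq_zero_iff _ incl_injective]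
    exact mul_ne_zero hb.ne_zero (pow_ne_zero _ PowerSeries.X_ne_zero)
  have hε : (HahnSeries.single 1 1 : k⸨X⸩) ≠ 0 := by simp
  change (t : Matrix (Fin 2) (Fin 2) k⸨X⸩) * _ = _ ↔ _
  rw [ramifiedGamma_eq]
  set c := incl k (b * PowerSeries.X ^ n)
  set T := (t : Matrix (Fin 2) (Fin 2) k⸨X⸩)
  rw [← Matrix.ext_iff]
  simp only [Matrix.mul_apply, Fin.sum_univ_two, Fin.forall_fin_two, Matrix.of_apply,
    Matrix.cons_val', Matrix.cons_val_zero, Matrix.cons_val_one, Matrix.empty_val',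
    Matrix.cons_val_fin_one, mul_zero, zero_add, add_zero, zero_mul]
  constructor
  · rintro ⟨⟨h00, h01⟩, -⟩
    exact ⟨mul_left_cancel₀ hne (by rw [← h01]; ring), mul_left_cancel₀ hne (by rw [← h00]; ring)⟩
  · rintro ⟨h1, h2⟩
    rw [h1, h2]
    refine ⟨⟨?_, ?_⟩, ?_, ?_⟩ <;> ring

/-- The element `[[0, 1], [ε, 0]]`, a uniformizer of the ramified torus. -/
def torusUniformizer : GL (Fin 2) k⸨X⸩ where
  val := !![0, 1; HahnSeries.single 1 1, 0]
  inv := !![0, HahnSeries.single (-1) 1; 1, 0]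
  val_inv := by
    ext i j : 1
    fin_cases i <;> fin_cases j <;>
      simp [Matrix.mul_apply, Fin.sum_univ_two, HahnSeries.single_mul_single]
  inv_val := by
    ext i j : 1
    fin_cases i <;> fin_cases j <;>
      simp [Matrix.mul_apply, Fin.sum_univ_two, HahnSeries.single_mul_single]

lemma nuG_torusUniformizer : nuG (cls k torusUniformizer) = 1 := by
  rw [nuG_cls]
  show (!![0, 1; HahnSeries.single 1 1, 0] : Matrix (Fin 2) (Fin 2) k⸨X⸩).det.order = 1
  rw [Matrix.det_fin_two_of]
  simp [HahnSeries.order_single]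

lemma torusUniformizer_mem_torus {b : k⟦X⟧} (hb : IsUnit b) (n : ℕ) :
    torusUniformizer ∈ torus (ramifiedGamma b n) := by
  rw [mem_torus_iff hb]
  simp [torusUniformizer]

/-- `T(𝒪)` is the whole kernel of `val ∘ det` on `T(F)`, as `T(F)` is the multiplicative group of
a ramified quadratic extension of `F`. -/
lemma mem_arcGroup_iff_of_mem_torus {b : k⟦X⟧} (hb : IsUnit b) {n : ℕ} {t : GL (Fin 2) k⸨X⸩}
    (ht : t ∈ torus (ramifiedGamma b n)) : t ∈ arcGroup k ↔ nuG (cls k t) = 0 := by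
  rw [mem_arcGroup_iff_nuG, and_iff_right_iff_imp]
  intro h0
  obtain ⟨h1, h2⟩ := (mem_torus_iff hb).mp ht
  have hdet : (t : Matrix (Fin 2) (Fin 2) k⸨X⸩).det =
      (t : Matrix (Fin 2) (Fin 2) k⸨X⸩) 0 0 ^ 2 -
        HahnSeries.single 1 1 * (t : Matrix (Fin 2) (Fin 2) k⸨X⸩) 0 1 ^ 2 := by
    rw [Matrix.det_fin_two, h1, h2]; ring
  rw [nuG_cls, hdet] at h0
  obtain ⟨hx, hy⟩ := (coeff_sq_sub_eq_zero_iff _ _ 0).mp fun j hj =>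
    HahnSeries.coeff_eq_zero_of_lt_order (by rw [h0]; exact hj)
  have hx' : (t : Matrix (Fin 2) (Fin 2) k⸨X⸩) 0 0 ∈ (incl k).range :=
    mem_range_incl_iff.mpr fun j hj => hx j (by omega)
  have hy' : (t : Matrix (Fin 2) (Fin 2) k⸨X⸩) 0 1 ∈ (incl k).range :=
    mem_range_incl_iff.mpr fun j hj => hy j (by omega)
  rw [mem_latticeGO_iff]
  intro i j
  fin_cases i <;> fin_cases j
  · exact hx'
  · exact hy'
  · show (t : Matrix (Fin 2) (Fin 2) k⸨X⸩) 1 0 ∈ (incl k).range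
    rw [h2]
    exact mul_mem ⟨PowerSeries.X, HahnSeries.ofPowerSeries_X⟩ hy'
  · show (t : Matrix (Fin 2) (Fin 2) k⸨X⸩) 1 1 ∈ (incl k).range
    rw [h1]
    exact hx'

end Torus

/-! ### Orbital integrals as numbers of cosets -/

section Measures

variable {k : Type*} [Field k]

/-- Every level set of `val ∘ det` on `T(F)` is a coset of `T(𝒪)`, hence has volume `1`. -/
lemma measure_torus_level {b : k⟦X⟧} (hb : IsUnit b) {n : ℕ}
    (dt : Measure (torus (ramifiedGamma b n))) [dt.IsMulLeftInvariant]
    (h1 : dt {t | (t : GL (Fin 2) k⸨X⸩) ∈ arcGroup k} = 1) (m : ℤ) :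
    dt {t | nuG (cls k (t : GL (Fin 2) k⸨X⸩)) = m} = 1 := by
  let w : torus (ramifiedGamma b n) := ⟨torusUniformizer, torusUniformizer_mem_torus hb n⟩
  rw [← h1, ← measure_preimage_mul dt (w ^ m)]
  congr 1
  ext t
  rw [Set.mem_preimage, Set.mem_ofPred_eq, Set.mem_ofPred_eq,
    mem_arcGroup_iff_of_mem_torus hb t.2]
  have : ((w ^ m * t : torus (ramifiedGamma b n)) : GL (Fin 2) k⸨X⸩) =
    torusUniformizer ^ m * (t : GL (Fin 2) k⸨X⸩) := rfl
  rw [this, nuG_mul, nuG_zpow, nuG_torusUniformizer]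
  omega

/-- The volume of a finite union of cosets of `GL₂(𝒪)` is the number of the cosets. -/
lemma measure_preimage_cls (dg : Measure (GL (Fin 2) k⸨X⸩)) [dg.IsMulLeftInvariant]
    (h1 : dg (arcGroup k : Set (GL (Fin 2) k⸨X⸩)) = 1) {s : Set (AffGr k)} (hs : s.Finite) :
    dg (cls k ⁻¹' s) = (s.ncard : ℝ≥0∞) := by
  have hpt : ∀ x : AffGr k, dg (cls k ⁻¹' {x}) = 1 := by
    intro x
    obtain ⟨g, rfl⟩ := QuotientGroup.mk_surjective x
    rw [← h1, ← measure_preimage_mul dg g⁻¹ (arcGroup k)]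
    congr 1
    ext h
    rw [Set.mem_preimage, Set.mem_singleton_iff, eq_comm]
    exact cls_eq_cls_iff
  have hU : cls k ⁻¹' s = ⋃ x ∈ hs.toFinset, cls k ⁻¹' {x} := by
    ext g; simp
  rw [hU, measure_biUnion_finset]
  · simp [hpt, Set.ncard_eq_toFinset_card s hs]
  · intro x _ y _ hxy
    exact Disjoint.preimage _ (Set.disjoint_singleton.mpr hxy)
  · exact fun x _ => (isOpen_preimage_cls {x}).measurableSet

/-- The set of `g` with `val (det g) = 0` meets each coset `T(F) g` in a set of volume `1`, so
that integrals over `T(F)\GL₂(F)` are integrals over this set. -/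
lemma exists_orbitalMeasures [Finite k] {b : k⟦X⟧} (hb : IsUnit b) (n : ℕ) :
    Nonempty (OrbitalMeasures (ramifiedGamma b n)) := by
  let γ := ramifiedGamma b n
  let K₀ : TopologicalSpace.PositiveCompacts (GL (Fin 2) k⸨X⸩) :=
    ⟨⟨arcGroup k, isCompact_arcGroup⟩, 1, by
      show _ ∈ interior (arcGroup k : Set (GL (Fin 2) k⸨X⸩))
      rw [isOpen_arcGroup.interior_eq]; exact one_mem _⟩
  let T₀ : TopologicalSpace.PositiveCompacts (torus γ) :=
    ⟨⟨{t | (t : GL (Fin 2) k⸨X⸩) ∈ arcGroup k},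
      (isClosed_torus γ).isClosedEmbedding_subtypeVal.isCompact_preimage isCompact_arcGroup⟩, 1, by
      show _ ∈ interior (Subtype.val ⁻¹' (arcGroup k : Set (GL (Fin 2) k⸨X⸩)))
      rw [(isOpen_arcGroup.preimage continuous_subtype_val).interior_eq]
      exact one_mem (arcGroup k)⟩
  let dg := Measure.haarMeasure K₀
  let dt := Measure.haarMeasure T₀
  have : SecondCountableTopology (torus γ) := TopologicalSpace.Subtype.secondCountableTopology _
  have hdt : dt {t | (t : GL (Fin 2) k⸨X⸩) ∈ arcGroup k} = 1 := Measure.haarMeasure_self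
  let G₀ : Set (GL (Fin 2) k⸨X⸩) := cls k ⁻¹' {x | nuG x = 0}
  have hG₀ : MeasurableSet G₀ := (isOpen_preimage_cls _).measurableSet
  have hmk : Measurable (tcls γ) := measurable_quotient_mk''
  refine ⟨⟨dg, dt, (dg.restrict G₀).map (tcls γ), inferInstance, inferInstance,
    Measure.haarMeasure_self, hdt, fun f Φ hf hΦ => ?_⟩⟩
  have hmul : Measurable fun p : GL (Fin 2) k⸨X⸩ × torus γ =>
      f ((p.2 : GL (Fin 2) k⸨X⸩) * p.1) :=
    hf.comp ((measurable_subtype_coe.comp measurable_snd).mul measurable_fst)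
  have hΦmk : Φ ∘ tcls γ = fun g => ∫⁻ t : torus γ, f ((t : GL (Fin 2) k⸨X⸩) * g) ∂dt :=
    funext hΦ
  have hΦm : Measurable Φ := by
    rw [measurable_from_quotient]
    show Measurable (Φ ∘ tcls γ)
    rw [hΦmk]
    exact hmul.lintegral_prod_right'
  let χ : GL (Fin 2) k⸨X⸩ → ℝ≥0∞ := G₀.indicator 1
  have hχ : Measurable χ := measurable_one.indicator hG₀
  symm
  calc ∫⁻ x, Φ x ∂((dg.restrict G₀).map (tcls γ))
      = ∫⁻ g in G₀, ∫⁻ t : torus γ, f ((t : GL (Fin 2) k⸨X⸩) * g) ∂dt ∂dg := by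
        rw [lintegral_map hΦm hmk]
        exact lintegral_congr hΦ
    _ = ∫⁻ g, ∫⁻ t : torus γ, χ g * f ((t : GL (Fin 2) k⸨X⸩) * g) ∂dt ∂dg := by
        rw [← lintegral_indicator hG₀]
        refine lintegral_congr fun g => ?_
        by_cases hg : g ∈ G₀ <;> simp [χ, hg]
    _ = ∫⁻ t : torus γ, ∫⁻ g, χ g * f ((t : GL (Fin 2) k⸨X⸩) * g) ∂dg ∂dt :=
        lintegral_lintegral_swap ((hχ.comp measurable_fst).mul hmul).aemeasurable
    _ = ∫⁻ t : torus γ, ∫⁻ g, χ ((t : GL (Fin 2) k⸨X⸩)⁻¹ * g) * f g ∂dg ∂dt := by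
        refine lintegral_congr fun t => ?_
        have := lintegral_mul_left_eq_self (μ := dg)
          (fun g => χ ((t : GL (Fin 2) k⸨X⸩)⁻¹ * g) * f g) (t : GL (Fin 2) k⸨X⸩)
        simpa only [inv_mul_cancel_left] using this
    _ = ∫⁻ g, ∫⁻ t : torus γ, χ ((t : GL (Fin 2) k⸨X⸩)⁻¹ * g) * f g ∂dt ∂dg := by
        refine lintegral_lintegral_swap (Measurable.aemeasurable ?_)
        exact (hχ.comp ((measurable_subtype_coe.comp measurable_fst).inv.mul measurable_snd)).mul
          (hf.comp measurable_snd)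
    _ = ∫⁻ g, f g ∂dg := by
        refine lintegral_congr fun g => ?_
        have hmeas : Measurable fun t : torus γ => χ ((t : GL (Fin 2) k⸨X⸩)⁻¹ * g) :=
          hχ.comp (measurable_subtype_coe.inv.mul_const g)
        let L : Set (torus γ) := {t | nuG (cls k (t : GL (Fin 2) k⸨X⸩)) = nuG (cls k g)}
        have hL : MeasurableSet L :=
          ((isOpen_preimage_cls {x | nuG x = nuG (cls k g)}).preimage
            continuous_subtype_val).measurableSet
        have hset : (fun t : torus γ => χ ((t : GL (Fin 2) k⸨X⸩)⁻¹ * g)) = L.indicator 1 := by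
          ext t
          have hiff : t ∈ L ↔ (t : GL (Fin 2) k⸨X⸩)⁻¹ * g ∈ G₀ := by
            show _ ↔ nuG (cls k ((t : GL (Fin 2) k⸨X⸩)⁻¹ * g)) = 0
            rw [nuG_mul, nuG_inv, neg_add_eq_zero]
            exact Iff.rfl
          by_cases h : t ∈ L
          · rw [Set.indicator_of_mem h]
            exact Set.indicator_of_mem (hiff.mp h) _
          · rw [Set.indicator_of_notMem h]
            exact Set.indicator_of_notMem (mt hiff.mpr h) _
        rw [lintegral_mul_const _ hmeas, hset, lintegral_indicator_one hL,
          measure_torus_level hb dt hdt, one_mul]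

lemma orbitalIntegrand_tcls (γ : Matrix (Fin 2) (Fin 2) k⸨X⸩) (g : GL (Fin 2) k⸨X⸩)
    [Decidable (cls k g ∈ springerFiber γ)] :
    orbitalIntegrand γ (tcls γ g) = if cls k g ∈ springerFiber γ then 1 else 0 := by
  have h : orbitalIntegrand γ (tcls γ g) =
    @ite _ (adInv g γ ∈ latticeGO k) (Classical.propDecidable _) 1 0 := rfl
  rw [h]
  congr 1
  exact propext cls_mem_springerFiber_iff.symm

lemma mul_mem_springerFiber_iff {γ : Matrix (Fin 2) (Fin 2) k⸨X⸩} {t : GL (Fin 2) k⸨X⸩}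
    (ht : t ∈ torus γ) (g : GL (Fin 2) k⸨X⸩) :
    cls k (t * g) ∈ springerFiber γ ↔ cls k g ∈ springerFiber γ := by
  rw [cls_mem_springerFiber_iff, cls_mem_springerFiber_iff, adInv_torus_mul ht]

lemma orbitalIntegral_eq_ncard {b : k⟦X⟧} (hb : IsUnit b) {n : ℕ}
    (m : OrbitalMeasures (ramifiedGamma b n))
    (hfin : {x ∈ springerFiber (ramifiedGamma b n) | nuG x = 0}.Finite) :
    orbitalIntegral m = ({x ∈ springerFiber (ramifiedGamma b n) | nuG x = 0}.ncard : ℝ≥0∞) := by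
  classical
  have := m.haar_dg
  have := m.haar_dt
  set S : Set (GL (Fin 2) k⸨X⸩) := cls k ⁻¹' {x ∈ springerFiber (ramifiedGamma b n) | nuG x = 0}
    with hS
  have hSm : MeasurableSet S := (isOpen_preimage_cls _).measurableSet
  rw [← measure_preimage_cls m.dg m.dg_arcGroup hfin, ← lintegral_indicator_one hSm]
  refine (m.quotient_formula _ _ (measurable_one.indicator hSm) fun g => ?_).symm
  rw [orbitalIntegrand_tcls]
  have hset : (fun t : torus (ramifiedGamma b n) =>
      S.indicator (1 : GL (Fin 2) k⸨X⸩ → ℝ≥0∞) ((t : GL (Fin 2) k⸨X⸩) * g)) =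
      {t : torus (ramifiedGamma b n) | cls k g ∈ springerFiber (ramifiedGamma b n) ∧
        nuG (cls k (t : GL (Fin 2) k⸨X⸩)) = -nuG (cls k g)}.indicator 1 := by
    ext t
    have : (t : GL (Fin 2) k⸨X⸩) * g ∈ S ↔ cls k g ∈ springerFiber (ramifiedGamma b n) ∧
        nuG (cls k (t : GL (Fin 2) k⸨X⸩)) = -nuG (cls k g) := by
      rw [hS, Set.mem_preimage, Set.mem_ofPred_eq, mul_mem_springerFiber_iff t.2, nuG_mul,
        eq_neg_iff_add_eq_zero]
    simp only [Set.indicator_apply, this, Set.mem_ofPred_eq, Pi.one_apply]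
  rw [hset]
  by_cases hg : cls k g ∈ springerFiber (ramifiedGamma b n)
  · simp only [hg, if_true, true_and]
    rw [lintegral_indicator_one, measure_torus_level hb m.dt m.dt_integral]
    exact ((isOpen_preimage_cls {x | nuG x = -nuG (cls k g)}).preimage
      continuous_subtype_val).measurableSet
  · simp [hg]

/-- As `𝔞_G^G = 0`, every weight factor is `1`. -/
lemma weightG_eq_one (ξ : aGG) (x : AffGr k) : weightG ξ x = 1 := by
  have hξ : (ξ : Fin 2 → ℝ) = 0 := by
    obtain ⟨h1, h2⟩ := ξ.2
    have h0 : (ξ : Fin 2 → ℝ) 0 = 0 := by linarith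
    ext i
    fin_cases i
    · exact h0
    · exact h1 ▸ h0
  have : {v | v ∈ Set.range latticeToAGG ∧ v + (ξ : Fin 2 → ℝ) ∈ EcG x} = {0} := by
    ext v
    simp only [hξ, EcG, HG, latticeToAGG_eq_zero, Set.mem_ofPred_eq, Set.mem_range, add_zero,
      convexHull_singleton, Set.mem_singleton_iff]
    exact ⟨fun h => h.2, fun h => ⟨⟨0, h.symm⟩, h⟩⟩
  rw [weightG, this, Set.encard_singleton]

lemma weightedOrbitalIntegral_eq {γ : Matrix (Fin 2) (Fin 2) k⸨X⸩} (m : OrbitalMeasures γ)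
    (ξ : aGG) : weightedOrbitalIntegral m ξ = orbitalIntegral m := by
  refine lintegral_congr fun x => ?_
  obtain ⟨g, rfl⟩ := Quotient.exists_rep x
  have : weightOnQuotient γ ξ (tcls γ g) = 1 := by
    show ((weightG ξ (cls k g) : ℕ∞) : ℝ≥0∞) = 1
    rw [weightG_eq_one]; simp
  rw [this, mul_one]

end Measures

/-! ### Counting the points of the affine Springer fiber -/

section Count

variable {k : Type*} [Field k]

/-- The matrix `[[1, u], [0, 1]] · diag(ε^a, ε^(-a))`. By the Iwasawa decomposition these represent
all classes in the affine Grassmannian with `ν_G = 0`. -/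
def iwasawaRep (a : ℤ) (u : k⸨X⸩) : GL (Fin 2) k⸨X⸩ where
  val := !![HahnSeries.single a 1, u * HahnSeries.single (-a) 1; 0, HahnSeries.single (-a) 1]
  inv := !![HahnSeries.single (-a) 1, -(u * HahnSeries.single (-a) 1); 0, HahnSeries.single a 1]
  val_inv := by
    ext i j : 1
    fin_cases i <;> fin_cases j <;>
      simp [Matrix.mul_apply, Fin.sum_univ_two, HahnSeries.single_mul_single]
    ring
  inv_val := by
    ext i j : 1
    fin_cases i <;> fin_cases j <;>
      simp [Matrix.mul_apply, Fin.sum_univ_two, HahnSeries.single_mul_single]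
    ring

lemma coe_iwasawaRep (a : ℤ) (u : k⸨X⸩) : (iwasawaRep a u : Matrix (Fin 2) (Fin 2) k⸨X⸩) =
    !![HahnSeries.single a 1, u * HahnSeries.single (-a) 1; 0, HahnSeries.single (-a) 1] := rfl

lemma coe_inv_iwasawaRep (a : ℤ) (u : k⸨X⸩) :
    (↑(iwasawaRep a u)⁻¹ : Matrix (Fin 2) (Fin 2) k⸨X⸩) =
    !![HahnSeries.single (-a) 1, -(u * HahnSeries.single (-a) 1); 0, HahnSeries.single a 1] := rfl

lemma nuG_iwasawaRep (a : ℤ) (u : k⸨X⸩) : nuG (cls k (iwasawaRep a u)) = 0 := by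
  rw [nuG_cls, coe_iwasawaRep, Matrix.det_fin_two_of, HahnSeries.single_mul_single]
  simp

lemma incl_mul_mem_range_iff {b : k⟦X⟧} (hb : IsUnit b) (n : ℕ) (x : k⸨X⸩) :
    incl k (b * PowerSeries.X ^ n) * x ∈ (incl k).range ↔ ∀ j < -(n : ℤ), x.coeff j = 0 := by
  rw [← single_mul_mem_range_incl_iff, map_mul, HahnSeries.ofPowerSeries_X_pow, mul_assoc]
  obtain ⟨b, rfl⟩ := hb
  refine ⟨fun h => ?_, fun h => mul_mem ⟨_, rfl⟩ h⟩
  have := mul_mem (⟨_, rfl⟩ : incl k (↑b⁻¹ : k⟦X⟧) ∈ (incl k).range) h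
  rwa [← mul_assoc, ← map_mul, Units.inv_mul, map_one, one_mul] at this

/-- The entries of `Ad(g)⁻¹ γ` for the representative `g` are, up to the factor `b εⁿ`, equal to
`∓εu`, `ε^(-2a) (1 - εu²)` and `ε^(2a + 1)`. -/
lemma iwasawaRep_mem_springerFiber_iff {b : k⟦X⟧} (hb : IsUnit b) (n : ℕ) (a : ℤ) (u : k⸨X⸩) :
    cls k (iwasawaRep a u) ∈ springerFiber (ramifiedGamma b n) ↔
      (-((n : ℤ) + 1) ≤ 2 * a ∧ 2 * a ≤ n) ∧ ∀ j, 2 * j + 1 + n < 2 * a → u.coeff j = 0 := by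
  have had : adInv (iwasawaRep a u) (ramifiedGamma b n) =
      !![incl k (b * PowerSeries.X ^ n) * (HahnSeries.single 1 1 * -u),
        incl k (b * PowerSeries.X ^ n) *
          (HahnSeries.single (-2 * a) 1 * (1 ^ 2 - HahnSeries.single 1 1 * u ^ 2));
        incl k (b * PowerSeries.X ^ n) * (HahnSeries.single (2 * a + 1) 1 * 1),
        incl k (b * PowerSeries.X ^ n) * (HahnSeries.single 1 1 * u)] := by
    have h0 : (HahnSeries.single a 1 * HahnSeries.single (-a) 1 : k⸨X⸩) = 1 := by
      simp [HahnSeries.single_mul_single]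
    have h1 : (HahnSeries.single (-2 * a) 1 : k⸨X⸩) = HahnSeries.single (-a) 1 ^ 2 := by
      rw [pow_two, HahnSeries.single_mul_single, mul_one]; congr 2; ring
    have h2 : (HahnSeries.single (2 * a + 1) 1 : k⸨X⸩) =
        HahnSeries.single a 1 ^ 2 * HahnSeries.single 1 1 := by
      rw [pow_two, HahnSeries.single_mul_single, HahnSeries.single_mul_single, mul_one, mul_one]
      congr 2; ring
    rw [adInv, coe_iwasawaRep, coe_inv_iwasawaRep, ramifiedGamma_eq, h1, h2]
    generalize incl k (b * PowerSeries.X ^ n) = c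
    generalize (HahnSeries.single 1 1 : k⸨X⸩) = e
    generalize (HahnSeries.single a 1 : k⸨X⸩) = s at h0 ⊢
    generalize (HahnSeries.single (-a) 1 : k⸨X⸩) = r at h0 ⊢
    ext i j : 1
    fin_cases i <;> fin_cases j <;> simp [Matrix.mul_apply, Fin.sum_univ_two]
    · linear_combination (c * e * u) * h0
    · ring
    · ring
    · linear_combination (c * e * u) * h0
  rw [cls_mem_springerFiber_iff, had, mem_latticeGO_iff]
  simp only [Fin.forall_fin_two, Matrix.of_apply, Matrix.cons_val', Matrix.cons_val_zero,
    Matrix.cons_val_one, Matrix.cons_val_fin_one, incl_mul_mem_range_iff hb, coeff_single_one_mul]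
  have h01 : (∀ j < -(n : ℤ),
      (1 ^ 2 - HahnSeries.single 1 1 * u ^ 2 : k⸨X⸩).coeff (j - -2 * a) = 0) ↔
      2 * a ≤ n ∧ ∀ j, 2 * j + 1 + n < 2 * a → u.coeff j = 0 := by
    have h := coeff_sq_sub_eq_zero_iff 1 u (2 * a - n)
    have hone : (∀ j : ℤ, 2 * j < 2 * a - n → (1 : k⸨X⸩).coeff j = 0) ↔ 2 * a ≤ n := by
      constructor
      · intro h
        by_contra! hlt
        simpa using h 0 (by omega)
      · intro h j hj
        rw [HahnSeries.coeff_one, if_neg (by omega)]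
    rw [hone] at h
    constructor
    · intro hc
      obtain ⟨h1, h2⟩ := h.mp fun j hj => by
        have := hc (j - 2 * a) (by omega)
        rwa [show j - 2 * a - -2 * a = j by ring] at this
      exact ⟨h1, fun j hj => h2 j (by omega)⟩
    · rintro ⟨h1, h2⟩ j hj
      exact h.mpr ⟨h1, fun j hj => h2 j (by omega)⟩ _ (by omega)
  have h10 : (∀ j < -(n : ℤ), (1 : k⸨X⸩).coeff (j - (2 * a + 1)) = 0) ↔
      -((n : ℤ) + 1) ≤ 2 * a := by
    constructor
    · intro h
      by_contra! hlt
      simpa using h (2 * a + 1) (by omega)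
    · intro h j hj
      rw [HahnSeries.coeff_one, if_neg (by omega)]
  rw [h01, h10]
  constructor
  · rintro ⟨⟨-, h1, h2⟩, h3, -⟩
    exact ⟨⟨h3, h1⟩, h2⟩
  · rintro ⟨⟨h3, h1⟩, h2⟩
    have h4 : ∀ j < -(n : ℤ), u.coeff (j - 1) = 0 := fun j hj => h2 _ (by omega)
    exact ⟨⟨fun j hj => by rw [HahnSeries.coeff_neg, h4 j hj, neg_zero], h1, h2⟩, h3, h4⟩

lemma cls_iwasawaRep_eq_iff {a a' : ℤ} {u u' : k⸨X⸩} :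
    cls k (iwasawaRep a u) = cls k (iwasawaRep a' u') ↔
      a = a' ∧ ∀ j < 2 * a, u'.coeff j = u.coeff j := by
  have hmul : ∀ a, (↑((iwasawaRep a u)⁻¹ * iwasawaRep a u') : Matrix (Fin 2) (Fin 2) k⸨X⸩) =
      !![1, HahnSeries.single (-2 * a) 1 * (u' - u); 0, 1] := by
    intro a
    have h1 : (HahnSeries.single (-(2 * a)) 1 : k⸨X⸩) = HahnSeries.single (-a) 1 ^ 2 := by
      rw [pow_two, HahnSeries.single_mul_single, mul_one]; congr 2; ring
    rw [Units.val_mul, coe_inv_iwasawaRep, coe_iwasawaRep]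
    ext i j : 1
    fin_cases i <;> fin_cases j <;>
      simp [Matrix.mul_apply, Fin.sum_univ_two, HahnSeries.single_mul_single]
    linear_combination (u - u') * h1
  have hcoeff : ∀ a, HahnSeries.single (-2 * a) 1 * (u' - u) ∈ (incl k).range ↔
      ∀ j < 2 * a, u'.coeff j = u.coeff j := by
    intro a
    rw [single_mul_mem_range_incl_iff]
    simp only [HahnSeries.coeff_sub, sub_eq_zero, neg_mul, neg_neg]
  rw [cls_eq_cls_iff]
  constructor
  · intro h
    have hL := mem_latticeGO_iff.mp (coe_mem_latticeGO h)
    have haa : a = a' := by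
      have h00 := hL 0 0
      have h11 := hL 1 1
      rw [Units.val_mul, coe_inv_iwasawaRep, coe_iwasawaRep] at h00 h11
      simp only [Matrix.mul_apply, Fin.sum_univ_two, Matrix.of_apply, Matrix.cons_val',
        Matrix.cons_val_zero, Matrix.cons_val_one, Matrix.cons_val_fin_one, mul_zero, zero_mul,
        add_zero, zero_add, HahnSeries.single_mul_single, mul_one] at h00 h11
      have key : ∀ m : ℤ, HahnSeries.single m (1 : k) ∈ (incl k).range → 0 ≤ m := by
        intro m hm
        by_contra! hlt
        simpa using mem_range_incl_iff.mp hm m hlt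
      have := key _ h00
      have := key _ h11
      omega
    subst haa
    refine ⟨rfl, (hcoeff a).mp ?_⟩
    have h01 := hL 0 1
    rw [hmul] at h01
    exact h01
  · rintro ⟨rfl, h⟩
    rw [mem_arcGroup_iff_nuG, nuG_mul, nuG_inv, nuG_iwasawaRep, nuG_iwasawaRep, hmul,
      mem_latticeGO_iff]
    refine ⟨fun i j => ?_, by simp⟩
    fin_cases i <;> fin_cases j
    · exact one_mem _
    · exact (hcoeff a).mpr h
    · exact zero_mem _
    · exact one_mem _

lemma exists_cls_eq_iwasawaRep {x : AffGr k} (hx : nuG x = 0) :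
    ∃ a u, x = cls k (iwasawaRep a u) := by
  obtain ⟨g, rfl⟩ := QuotientGroup.mk_surjective x
  set α := (g : Matrix (Fin 2) (Fin 2) k⸨X⸩) 0 0 with hα
  set β := (g : Matrix (Fin 2) (Fin 2) k⸨X⸩) 0 1 with hβ
  set c := (g : Matrix (Fin 2) (Fin 2) k⸨X⸩) 1 0 with hc
  set d := (g : Matrix (Fin 2) (Fin 2) k⸨X⸩) 1 1 with hd
  have hdet : (g : Matrix (Fin 2) (Fin 2) k⸨X⸩).det = α * d - β * c := Matrix.det_fin_two _
  have hne := det_ne_zero_GL g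
  have h0 : (α * d - β * c).order = 0 := by rw [← hdet]; exact hx
  rw [hdet] at hne
  -- Since `det` has valuation `0`, only the integrality of `(iwasawaRep a u)⁻¹ * g` matters.
  suffices h : ∃ (a : ℤ) (u : k⸨X⸩), HahnSeries.single (-a) 1 * (α - u * c) ∈ (incl k).range ∧
      HahnSeries.single (-a) 1 * (β - u * d) ∈ (incl k).range ∧
      HahnSeries.single a 1 * c ∈ (incl k).range ∧
      HahnSeries.single a 1 * d ∈ (incl k).range by
    obtain ⟨a, u, h1, h2, h3, h4⟩ := h
    refine ⟨a, u, (cls_eq_cls_iff.mpr ?_).symm⟩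
    rw [mem_arcGroup_iff_nuG, nuG_mul, nuG_inv, nuG_iwasawaRep, neg_zero, zero_add]
    refine ⟨?_, hx⟩
    rw [Units.val_mul, coe_inv_iwasawaRep, Matrix.eta_fin_two (g : Matrix (Fin 2) (Fin 2) k⸨X⸩),
      ← hα, ← hβ, ← hc, ← hd, mem_latticeGO_iff]
    intro i j
    fin_cases i <;> fin_cases j <;> simp [-RingHom.mem_range, Matrix.mul_apply, Fin.sum_univ_two]
    · convert h1 using 1; ring
    · convert h2 using 1; ring
    · exact h3
    · exact h4
  have horder : ∀ (z w : k⸨X⸩), z * w ≠ 0 → (z * w).order = 0 →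
      HahnSeries.single w.order 1 * z ∈ (incl k).range := by
    intro z w hzw hord
    rw [HahnSeries.order_mul (left_ne_zero_of_mul hzw) (right_ne_zero_of_mul hzw)] at hord
    rw [single_mul_mem_range_incl_iff]
    exact fun j hj => HahnSeries.coeff_eq_zero_of_lt_order (by omega)
  have hint : ∀ (z : k⸨X⸩) (m : ℤ), (z ≠ 0 → m ≤ z.order) →
      HahnSeries.single (-m) 1 * z ∈ (incl k).range := by
    intro z m hm
    by_cases hz : z = 0
    · rw [hz, mul_zero]; exact zero_mem _
    · rw [single_mul_mem_range_incl_iff]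
      have := hm hz
      exact fun j hj => HahnSeries.coeff_eq_zero_of_lt_order (by omega)
  by_cases hcase : d ≠ 0 ∧ (c ≠ 0 → d.order ≤ c.order)
  · obtain ⟨hd0, hcd⟩ := hcase
    have hz : (α - β / d * c) * d = α * d - β * c := by field_simp
    refine ⟨-d.order, β / d, ?_, ?_, hint c _ hcd, hint d _ fun _ => le_rfl⟩
    · rw [neg_neg]
      exact horder _ _ (by rwa [hz]) (by rwa [hz])
    · rw [div_mul_cancel₀ _ hd0, sub_self, mul_zero]
      exact zero_mem _
  · have hc0 : c ≠ 0 := by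
      rintro hc0
      refine hcase ⟨?_, fun h => absurd hc0 h⟩
      rintro hd0
      exact hne (by rw [hc0, hd0]; ring)
    have hdc : d ≠ 0 → c.order ≤ d.order := by
      intro hd0
      by_contra! hlt
      exact hcase ⟨hd0, fun _ => hlt.le⟩
    have hz : (β - α / c * d) * c = -(α * d - β * c) := by field_simp; ring
    refine ⟨-c.order, α / c, ?_, ?_, hint c _ fun _ => le_rfl, hint d _ hdc⟩
    · rw [div_mul_cancel₀ _ hc0, sub_self, mul_zero]
      exact zero_mem _
    · rw [neg_neg]
      exact horder _ _ (by rw [hz]; exact neg_ne_zero.mpr hne)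
        (by rw [hz, HahnSeries.order_neg]; exact h0)

/-- The Laurent polynomial with coefficients `c 0, …, c (i - 1)` in degrees `l, …, l + i - 1`. -/
def laurentPoly (l : ℤ) {i : ℕ} (c : Fin i → k) : k⸨X⸩ :=
  HahnSeries.single l 1 * incl k (PowerSeries.mk fun m => if h : m < i then c ⟨m, h⟩ else 0)

lemma coeff_laurentPoly (l : ℤ) {i : ℕ} (c : Fin i → k) (m : Fin i) :
    (laurentPoly l c).coeff (l + m) = c m := by
  rw [laurentPoly, coeff_single_one_mul]
  refine (PowerSeries.coeff_coe _ _).trans ?_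
  simp

lemma coeff_laurentPoly_of_lt (l : ℤ) {i : ℕ} (c : Fin i → k) {j : ℤ} (hj : j < l) :
    (laurentPoly l c).coeff j = 0 := by
  rw [laurentPoly, coeff_single_one_mul]
  exact (PowerSeries.coeff_coe _ _).trans (if_pos (by omega))

/-- The points of `𝒳_γ` with `ν_G = 0`: for `0 ≤ i ≤ n`, the coefficients of `u`, taken modulo
`ε^(2a)` with `a = i - ⌊(n + 1) / 2⌋`, that the condition on `u` leaves free. -/
def fiberPoint (n : ℕ) (p : Σ i : Fin (n + 1), Fin i → k) : AffGr k :=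
  cls k (iwasawaRep ((p.1 : ℤ) - ((n + 1) / 2 : ℕ))
    (laurentPoly ((p.1 : ℤ) - 2 * ((n + 1) / 2 : ℕ)) p.2))

lemma fiberPoint_injective (n : ℕ) : Function.Injective (fiberPoint (k := k) n) := by
  rintro ⟨i, c⟩ ⟨i', c'⟩ h
  obtain ⟨h1, h2⟩ := cls_iwasawaRep_eq_iff.mp h
  obtain rfl : i = i' := by
    ext; simp only at h1; omega
  congr 1
  funext m
  have hm := m.2
  have := h2 ((i : ℤ) - 2 * ((n + 1) / 2 : ℕ) + (m : ℕ)) (by simp only; omega)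
  rw [coeff_laurentPoly, coeff_laurentPoly] at this
  exact this.symm

lemma range_fiberPoint {b : k⟦X⟧} (hb : IsUnit b) (n : ℕ) :
    Set.range (fiberPoint n) = {x ∈ springerFiber (ramifiedGamma b n) | nuG x = 0} := by
  ext x
  constructor
  · rintro ⟨⟨i, c⟩, rfl⟩
    refine ⟨(iwasawaRep_mem_springerFiber_iff hb n _ _).mpr ⟨?_, fun j hj => ?_⟩,
      nuG_iwasawaRep _ _⟩
    · have := i.2
      simp only
      omega
    · exact coeff_laurentPoly_of_lt _ _ (by simp only at hj ⊢; omega)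
  · rintro ⟨hx, h0⟩
    obtain ⟨a, u, rfl⟩ := exists_cls_eq_iwasawaRep h0
    obtain ⟨⟨ha1, ha2⟩, hu⟩ := (iwasawaRep_mem_springerFiber_iff hb n a u).mp hx
    obtain ⟨i, hi⟩ : ∃ i : ℕ, (i : ℤ) = a + ((n + 1) / 2 : ℕ) :=
      ⟨(a + ((n + 1) / 2 : ℕ)).toNat, by omega⟩
    refine ⟨⟨⟨i, by omega⟩, fun m => u.coeff ((i : ℤ) - 2 * ((n + 1) / 2 : ℕ) + (m : ℕ))⟩,
      cls_iwasawaRep_eq_iff.mpr ⟨?_, fun j hj => ?_⟩⟩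
    · simp only; omega
    · simp only at hj ⊢
      by_cases hlow : j < (i : ℤ) - 2 * ((n + 1) / 2 : ℕ)
      · rw [coeff_laurentPoly_of_lt _ _ hlow]
        exact hu j (by omega)
      · obtain ⟨m, hm⟩ : ∃ m : ℕ, (i : ℤ) - 2 * ((n + 1) / 2 : ℕ) + (m : ℕ) = j :=
          ⟨(j - ((i : ℤ) - 2 * ((n + 1) / 2 : ℕ))).toNat, by omega⟩
        have hmi : m < i := by omega
        have := coeff_laurentPoly ((i : ℤ) - 2 * ((n + 1) / 2 : ℕ))
          (fun m : Fin i => u.coeff ((i : ℤ) - 2 * ((n + 1) / 2 : ℕ) + (m : ℕ))) ⟨m, hmi⟩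
        simp only [hm] at this
        exact this.symm

lemma finite_springerFiber_zero [Finite k] {b : k⟦X⟧} (hb : IsUnit b) (n : ℕ) :
    {x ∈ springerFiber (ramifiedGamma b n) | nuG x = 0}.Finite := by
  rw [← range_fiberPoint hb]
  exact Set.finite_range _

lemma ncard_springerFiber_zero [Fintype k] {b : k⟦X⟧} (hb : IsUnit b) (n : ℕ) :
    {x ∈ springerFiber (ramifiedGamma b n) | nuG x = 0}.ncard =
      ∑ i ∈ Finset.range (n + 1), Fintype.card k ^ i := by
  classical
  rw [← range_fiberPoint hb, ← Set.image_univ, Set.ncard_image_of_injective _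
    (fiberPoint_injective n), Set.ncard_univ, Nat.card_eq_fintype_card, Fintype.card_sigma,
    Finset.sum_range]
  simp

/-- Since all polytopes `Ec_G` coincide, the fundamental domain is a level set of `ν_G` on
`𝒳_γ`, and a power of the uniformizer of the torus carries the level `0` onto it. -/
lemma fundamentalDomain_eq_image {b : k⟦X⟧} (hb : IsUnit b) (n : ℕ) (x₀ : AffGr k) :
    fundamentalDomain (ramifiedGamma b n) x₀ =
      (fun x : AffGr k => (torusUniformizer ^ nuG x₀ : GL (Fin 2) k⸨X⸩) • x) ''
        {x ∈ springerFiber (ramifiedGamma b n) | nuG x = 0} := by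
  set w : GL (Fin 2) k⸨X⸩ := torusUniformizer ^ nuG x₀ with hw
  have hwt : w ∈ torus (ramifiedGamma b n) := zpow_mem (torusUniformizer_mem_torus hb n) _
  have hwn : nuG (cls k w) = nuG x₀ := by
    rw [hw, nuG_zpow, nuG_torusUniformizer, mul_one]
  ext x
  obtain ⟨g, rfl⟩ := QuotientGroup.mk_surjective x
  constructor
  · rintro ⟨h1, -, h2⟩
    refine ⟨cls k (w⁻¹ * g), ⟨(mul_mem_springerFiber_iff (inv_mem hwt) g).mpr h1, ?_⟩, ?_⟩
    · rw [nuG_mul, nuG_inv, hwn]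
      have : nuG (cls k g) = nuG x₀ := h2
      omega
    · show cls k (w * (w⁻¹ * g)) = _
      rw [mul_inv_cancel_left]
  · rintro ⟨y, ⟨h1, h2⟩, hy⟩
    obtain ⟨h, rfl⟩ := QuotientGroup.mk_surjective y
    rw [← hy]
    refine ⟨(mul_mem_springerFiber_iff hwt h).mpr h1, ?_, ?_⟩
    · simp only [EcG, HG, latticeToAGG_eq_zero]
      exact subset_rfl
    · have : nuG (cls k (w * h)) = nuG x₀ := by
        rw [nuG_mul, hwn]
        have : nuG (cls k h) = 0 := h2
        omega
      exact this

end Count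

/-! ### Regular points -/

section Regular

variable {k : Type*} [Field k]

lemma isRegularMatrix_of_offDiag {β β' : k} (h : β ≠ 0 ∨ β' ≠ 0) :
    IsRegularMatrix !![0, β; β', 0] := by
  set A : Matrix (Fin 2) (Fin 2) k := !![0, β; β', 0] with hA
  let φ : k × k →ₗ[k] Subalgebra.centralizer k ({A} : Set (Matrix (Fin 2) (Fin 2) k)) :=
    { toFun := fun p => ⟨p.1 • 1 + p.2 • A, by
        rw [Subalgebra.mem_centralizer_iff]
        rintro _ rfl
        simp [mul_add, add_mul]⟩
      map_add' := fun p p' => Subtype.ext (by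
        show (p.1 + p'.1) • (1 : Matrix (Fin 2) (Fin 2) k) + (p.2 + p'.2) • A = _ + _
        rw [add_smul, add_smul]; exact add_add_add_comm _ _ _ _)
      map_smul' := fun r p => Subtype.ext (by
        show (r * p.1) • (1 : Matrix (Fin 2) (Fin 2) k) + (r * p.2) • A = r • (_ + _)
        rw [smul_add, mul_smul, mul_smul]) }
  have hφ : ∀ p, (φ p : Matrix (Fin 2) (Fin 2) k) = !![p.1, p.2 * β; p.2 * β', p.1] := by
    intro p
    show p.1 • (1 : Matrix (Fin 2) (Fin 2) k) + p.2 • A = _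
    ext i j : 1
    fin_cases i <;> fin_cases j <;> simp [hA]
  have hbij : Function.Bijective φ := by
    constructor
    · rw [injective_iff_map_eq_zero]
      rintro ⟨x, y⟩ h0
      have h1 := hφ (x, y)
      rw [h0] at h1
      have hx : x = 0 := (congrFun (congrFun h1 0) 0).symm
      have hy : y * β = 0 := (congrFun (congrFun h1 0) 1).symm
      have hy' : y * β' = 0 := (congrFun (congrFun h1 1) 0).symm
      have : y = 0 := by
        rcases h with h | h
        · exact (mul_eq_zero.mp hy).resolve_right h
        · exact (mul_eq_zero.mp hy').resolve_right h
      rw [hx, this]; rfl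
    · rintro ⟨M, hM⟩
      have hc : A * M = M * A := (Subalgebra.mem_centralizer_iff k).mp hM A rfl
      have h00 : β * M 1 0 = M 0 1 * β' := by
        simpa [hA, Matrix.mul_apply, Fin.sum_univ_two] using congrFun (congrFun hc 0) 0
      have h01 : β * M 1 1 = M 0 0 * β := by
        simpa [hA, Matrix.mul_apply, Fin.sum_univ_two] using congrFun (congrFun hc 0) 1
      have h10 : β' * M 0 0 = M 1 1 * β' := by
        simpa [hA, Matrix.mul_apply, Fin.sum_univ_two] using congrFun (congrFun hc 1) 0
      rcases h with h | h
      · refine ⟨(M 0 0, M 0 1 / β), Subtype.ext ?_⟩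
        rw [hφ]
        ext i j : 1
        fin_cases i <;> fin_cases j
        · rfl
        · exact div_mul_cancel₀ _ h
        · show M 0 1 / β * β' = M 1 0
          field_simp; linear_combination -h00
        · show M 0 0 = M 1 1
          exact mul_left_cancel₀ h (by linear_combination -h01)
      · refine ⟨(M 0 0, M 1 0 / β'), Subtype.ext ?_⟩
        rw [hφ]
        ext i j : 1
        fin_cases i <;> fin_cases j
        · rfl
        · show M 1 0 / β' * β = M 0 1
          field_simp; linear_combination h00
        · exact div_mul_cancel₀ _ h
        · show M 0 0 = M 1 1
          exact mul_left_cancel₀ h (by linear_combination h10)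
  rw [IsRegularMatrix, ← (LinearEquiv.ofBijective φ hbij).finrank_eq]
  simp

/-- According to the parity of `n`, one of the two off-diagonal entries of `γ` becomes the unit
`b₀` after conjugation by `diag(ε^a, ε^(-a))`, with `a = n / 2` or `a = -(n + 1) / 2`. -/
lemma exists_isRegularPoint {b : k⟦X⟧} (hb : IsUnit b) (n : ℕ) :
    ∃ x₀ : AffGr k, IsRegularPoint (ramifiedGamma b n) x₀ ∧ nuG x₀ = 0 := by
  have hb0 : PowerSeries.constantCoeff b ≠ 0 := (hb.map PowerSeries.constantCoeff).ne_zero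
  have had : ∀ a : ℤ, adInv (epsDiag k a (-a)) (ramifiedGamma b n) =
      !![0, HahnSeries.single (n - 2 * a) 1 * incl k b;
        HahnSeries.single (n + 1 + 2 * a) 1 * incl k b, 0] := by
    intro a
    rw [adInv_epsDiag, ramifiedGamma_eq, map_mul, HahnSeries.ofPowerSeries_X_pow]
    have key : ∀ m m' l : ℤ, m + m' = l → ∀ z : k⸨X⸩,
        HahnSeries.single m 1 * (z * HahnSeries.single m' 1) = HahnSeries.single l 1 * z := by
      rintro m m' _ rfl z
      rw [← mul_one (1 : k), ← HahnSeries.single_mul_single, mul_one]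
      ring
    ext i j : 1
    fin_cases i <;> fin_cases j
    · simp
    · exact key _ _ _ (by ring) _
    · show HahnSeries.single (a - -a) 1 * (HahnSeries.single 1 1 *
        (incl k b * HahnSeries.single (n : ℤ) 1)) = HahnSeries.single (n + 1 + 2 * a) 1 * incl k b
      rw [key 1 n _ rfl, ← mul_assoc, HahnSeries.single_mul_single, mul_one]
      congr 2
      ring_nf
    · simp
  have hX : (HahnSeries.single (2 * (n : ℤ) + 1) 1 : k⸨X⸩) =
      incl k (PowerSeries.X ^ (2 * n + 1)) := by
    rw [HahnSeries.ofPowerSeries_X_pow]; push_cast; rfl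
  rcases Nat.even_or_odd' n with ⟨f, hf | hf⟩
  · refine ⟨cls k (epsDiag k f (-f)), ⟨epsDiag k f (-f),
      !![0, b; PowerSeries.X ^ (2 * n + 1) * b, 0], rfl, ?_, ?_⟩, ?_⟩
    · rw [had, show (n : ℤ) - 2 * f = 0 by omega, show (n : ℤ) + 1 + 2 * f = 2 * n + 1 by omega, hX]
      ext i j : 1
      fin_cases i <;> fin_cases j <;> simp
    · convert isRegularMatrix_of_offDiag (β' := 0) (Or.inl hb0) using 1
      ext i j : 1
      fin_cases i <;> fin_cases j <;> simp
    · rw [nuG_epsDiag]; ring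
  · refine ⟨cls k (epsDiag k (-(f + 1)) (- -(f + 1))), ⟨epsDiag k (-(f + 1)) (- -(f + 1)),
      !![0, PowerSeries.X ^ (2 * n + 1) * b; b, 0], rfl, ?_, ?_⟩, ?_⟩
    · rw [had, show (n : ℤ) - 2 * -(f + 1) = 2 * n + 1 by omega,
        show (n : ℤ) + 1 + 2 * -(f + 1) = 0 by omega, hX]
      ext i j : 1
      fin_cases i <;> fin_cases j <;> simp
    · convert isRegularMatrix_of_offDiag (β := 0) (Or.inr hb0) using 1
      ext i j : 1
      fin_cases i <;> fin_cases j <;> simp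
    · rw [nuG_epsDiag]; ring

end Regular

end GL2Springer

end

theorem mainTheorem7 {k : Type*} [Field k] [Fintype k] (hchar : 2 < ringChar k)
    (n : ℕ) (b₀ : PowerSeries k) (hb₀ : IsUnit b₀) :
    -- intersections with the Iwahori orbits, on points in all `k`-algebras `R`
    (∀ (R : Type*) [CommRing R] [Algebra k R] (a₁ a₂ : ℤ),
      ((-((n : ℤ) + 1) ≤ a₁ - a₂ ∧ a₁ - a₂ ≤ n) →
        GL2Springer.springerFiber
            (GL2Springer.ramifiedGamma (PowerSeries.map (algebraMap k R) b₀) n) ∩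
          GL2Springer.iwahoriOrbit R a₁ a₂ = GL2Springer.iwahoriOrbit R a₁ a₂) ∧
      (¬ (-((n : ℤ) + 1) ≤ a₁ - a₂ ∧ a₁ - a₂ ≤ n) → Nontrivial R →
        GL2Springer.springerFiber
            (GL2Springer.ramifiedGamma (PowerSeries.map (algebraMap k R) b₀) n) ∩
          GL2Springer.iwahoriOrbit R a₁ a₂ = ∅)) ∧
    -- the normalized measures exist, and there is a regular point with `ν_G = 0`
    Nonempty (GL2Springer.OrbitalMeasures (GL2Springer.ramifiedGamma b₀ n)) ∧
    (∃ x₀ : GL2Springer.AffGr k,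
      GL2Springer.IsRegularPoint (GL2Springer.ramifiedGamma b₀ n) x₀ ∧
        GL2Springer.nuG x₀ = 0) ∧
    -- the values of the two integrals and the cardinality of the fundamental domain
    (∀ (m : GL2Springer.OrbitalMeasures (GL2Springer.ramifiedGamma b₀ n))
        (ξ : GL2Springer.aGG) (x₀ : GL2Springer.AffGr k),
      GL2Springer.IsRegularPoint (GL2Springer.ramifiedGamma b₀ n) x₀ →
        GL2Springer.weightedOrbitalIntegral m ξ = GL2Springer.orbitalIntegral m ∧
        GL2Springer.orbitalIntegral m =
          (Set.ncard (GL2Springer.fundamentalDomain (GL2Springer.ramifiedGamma b₀ n) x₀) :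
            ENNReal) ∧
        (GL2Springer.fundamentalDomain (GL2Springer.ramifiedGamma b₀ n) x₀).Finite ∧
        Set.ncard (GL2Springer.fundamentalDomain (GL2Springer.ramifiedGamma b₀ n) x₀) =
          ∑ i ∈ Finset.range (n + 1), Fintype.card k ^ i) := by
  have hfin := GL2Springer.finite_springerFiber_zero hb₀ n
  refine ⟨fun R _ _ a₁ a₂ => ?_, GL2Springer.exists_orbitalMeasures hb₀ n,
    GL2Springer.exists_isRegularPoint hb₀ n, fun m ξ x₀ _ => ?_⟩
  · have hb : IsUnit (PowerSeries.map (algebraMap k R) b₀) := hb₀.map _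
    refine ⟨fun h => Set.inter_eq_right.mpr fun x hx =>
      GL2Springer.mem_springerFiber_of_mem_iwahoriOrbit hb h hx, fun h _ => ?_⟩
    refine Set.eq_empty_of_forall_notMem fun x hx => h ?_
    exact GL2Springer.bounds_of_mem_springerFiber_of_mem_iwahoriOrbit hb hx.2 hx.1
  · have hcard : (GL2Springer.fundamentalDomain (GL2Springer.ramifiedGamma b₀ n) x₀).ncard =
        {x ∈ GL2Springer.springerFiber (GL2Springer.ramifiedGamma b₀ n) |
          GL2Springer.nuG x = 0}.ncard := by
      rw [GL2Springer.fundamentalDomain_eq_image hb₀]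
      exact Set.ncard_image_of_injective _ (MulAction.injective _)
    refine ⟨GL2Springer.weightedOrbitalIntegral_eq m ξ, ?_, ?_, ?_⟩
    · rw [hcard, GL2Springer.orbitalIntegral_eq_ncard hb₀ m hfin]
    · rw [GL2Springer.fundamentalDomain_eq_image hb₀]
      exact hfin.image _
    · rw [hcard, GL2Springer.ncard_springerFiber_zero hb₀]
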